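/- **Setting.** There are $N$ agents. Agent $i$ has a strategy set $\Omega_i\subset\mathbb R^n$, a cost $J_i:\mathbb R^n\times\mathbb R^n\to\mathbb R$, a matrix $C_i\in\mathbb R^{m\times n}$ and a vector $c_i\in\mathbb R^m$. Write $\boldsymbol x=\mathrm{col}(x_1,\dots,x_N)$, $\bar x=\frac1N\sum_i x_i$, $C\boldsymbol x-c=\sum_i(C_ix_i-c_i)$, $\boldsymbol\Omega=\prod_i\Omega_i$, $K=\{\boldsymbol x\in\boldsymbol\Omega: C\boldsymbol x-c\le 0\}$, and let $\bar\Omega$ be the convex hull of $\bigcup_i\Omega_i$. All norms are Euclidean (for matrices, the largest singular value). Put $$F(\boldsymbol x)=\mathrm{col}\big(\nabla_{x_i}[J_i(x_i,\tfrac1Nx_i+\tfrac1N\textstyle\sum_{j\ne i}x_j)]\big)_i,\quad F_i(v,w)=\nabla_1J_i(v,w)+\tfrac1N\nabla_2J_i(v,w),\quad \boldsymbol F(\boldsymbol v,\boldsymbol w)=\mathrm{col}(F_i(v_i,w_i))_i$$ (a partial gradient that does not exist is read as $0$). A point $\boldsymbol x^*\in K$ is a GNE if for all $i$ and all $z$ with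 $(z,\boldsymbol x^*_{-i})\in K$ one has $J_i(x_i^*,\bar x^*)\le J_i(z,\frac1Nz+\frac1N\sum_{j\ne i}x_j^*)$. It is a variational GNE (v-GNE) if moreover there is one $\lambda\in\mathbb R^m_{\ge0}$ with $0\in F(\boldsymbol x^*)_i+\mathrm N_{\Omega_i}(x_i^*)+C_i^\top\lambda$ for all $i$ and $0\le\lambda\perp-(C\boldsymbol x^*-c)\ge0$, where $\mathrm N$ is the normal cone. For $\boldsymbol\lambda=\mathrm{col}(\lambda_1,\dots,\lambda_N)\in\mathbb R^{mN}$ let $$T(\boldsymbol x,\boldsymbol\lambda)=\Big(\mathrm N_{\boldsymbol\Omega}(\boldsymbol x)+F(\boldsymbol x)+\mathrm{col}(C_i^\top\bar\lambda)_i,\ \ \mathrm N_{\mathbb R^{mN}_{\ge0}}(\boldsymbol\lambda)+\mathrm{col}\big(\lambda_i-\bar\lambda-\tfrac1N(C\boldsymbol x-c)\big)_i\Big).$$ **Assumptions.** 1. Each $\Omega_i$ is nonempty, compact and convex. For each $i$ and each $u\in\frac1N\sum_{j\ne i}\Omega_j$, the function $z\mapsto J_i(z,\frac1Nz+u)$ is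 convex and continuously differentiable on $\Omega_i$. Each $J_i$ is differentiable at every point of $\Omega_i\times\bar\Omega$. There is $\boldsymbol x\in\boldsymbol\Omega$ with $C\boldsymbol x-c<0$ componentwise. 2. For some $\chi>0$, $(F(\boldsymbol x)-F(\boldsymbol y))^\top(\boldsymbol x-\boldsymbol y)\ge\chi\|F(\boldsymbol x)-F(\boldsymbol y)\|^2$ for all $\boldsymbol x,\boldsymbol y\in\boldsymbol\Omega$. 3. $\boldsymbol F$ is Lipschitz continuous on $\boldsymbol\Omega\times\bar\Omega^N$. 4. $(\mathcal G_k)_{k\ge0}$ are undirected graphs with edge sets $\mathcal E_k$ on $\{1,\dots,N\}$ such that for some integer $Q\ge1$ the graph with edge set $\bigcup_{\ell=1}^Q\mathcal E_{k+\ell}$ is connected for every $k\ge0$. The matrices $W(k)=[w_{i,j}(k)]$ have all row and column sums equal to $1$, and for some $\varepsilon>0$ and all $k$: $w_{i,i}(k)>\varepsilon$ and, for $i\ne j$, $w_{i,j}(k)\ge\varepsilon$ if $(i,j)\in\mathcal E_k$ and $w_{i,j}(k)=0$ otherwise. 5. $0<\delta\le\min\{1,\chi\}$, $\tau>\frac1{2\delta}$,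 $0<\alpha_i\le(\|C_i\|+\tau)^{-1}$ and $0<\beta_i\le(\frac1N\sum_j\|C_j\|+\tau)^{-1}$ for all $i$. 6. $0\le\gamma^{k+1}\le\gamma^k\le1$ for all $k\ge0$, $\sum_k\gamma^k=\infty$ and $\sum_k(\gamma^k)^2<\infty$. If $\gamma^0=1$, then for some $r>0$ the map $\boldsymbol F$ is, moreover, Lipschitz continuous on $\boldsymbol\Omega\times(\bar\Omega_r)^N$, where $\bar\Omega_r$ is the open $r$-neighbourhood of $\bar\Omega$. **Algorithm.** Choose $x_i^{-1},x_i^0,\tilde x_i^{-1}\in\Omega_i$ and $\lambda_i^0\in\mathbb R^m_{\ge0}$ arbitrarily; set $\sigma_i^0=x_i^0$, $z_i^0=\lambda_i^0$, $y_i^0=2C_i\tilde x_i^{-1}-C_ix_i^{-1}-c_i$. For $k=0,1,\dots$ and all $i$: $\hat\sigma_i^k=\sum_jw_{i,j}(k)\sigma_j^k$, $\hat y_i^k=\sum_jw_{i,j}(k)y_j^k$, $\hat z_i^k=\sum_jw_{i,j}(k)z_j^k$; $$\begin{aligned}\tilde x_i^k&=\mathrm{proj}_{\Omega_i}\big(x_i^k-\alpha_i(F_i(x_i^k,\hat\sigma_i^k)+C_i^\top\hat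 z_i^k)\big),\\ y_i^{k+1}&=\hat y_i^k+C_i(2\tilde x_i^k-x_i^k)-C_i(2\tilde x_i^{k-1}-x_i^{k-1}),\\ \tilde\lambda_i^k&=\mathrm{proj}_{\mathbb R^m_{\ge0}}\big(\lambda_i^k+\beta_i(y_i^{k+1}-\lambda_i^k+\hat z_i^k)\big),\\ x_i^{k+1}&=x_i^k+\gamma^k(\tilde x_i^k-x_i^k),\qquad\lambda_i^{k+1}=\lambda_i^k+\gamma^k(\tilde\lambda_i^k-\lambda_i^k),\\ \sigma_i^{k+1}&=\hat\sigma_i^k+x_i^{k+1}-x_i^k,\qquad z_i^{k+1}=\hat z_i^k+\lambda_i^{k+1}-\lambda_i^k.\end{aligned}$$ **Theorem.** Under assumptions 1–6, if the dual sequence $(\boldsymbol\lambda^k)_{k\ge0}$ generated by the algorithm is bounded, then $(\boldsymbol x^k,\boldsymbol\lambda^k)$ converges to some $(\boldsymbol x^*,\boldsymbol\lambda^*)$ with $0\in T(\boldsymbol x^*,\boldsymbol\lambda^*)$, and $\boldsymbol x^*$ is a variational GNE. -/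

import Mathlib

open Filter Topology

noncomputable section

/-- `ℝ^d` with the Euclidean norm. -/
abbrev Vec (d : ℕ) := EuclideanSpace ℝ (Fin d)

/-- Stacked vectors `col(x_1, …, x_N)` with `x_i ∈ ℝ^d`, with the Euclidean norm of `ℝ^{dN}`. -/
abbrev Stack (N d : ℕ) := PiLp 2 (fun _ : Fin N => Vec d)

/-- The stacked vector with blocks `f i`. -/
def col {N d : ℕ} (f : Fin N → Vec d) : Stack N d := WithLp.toLp 2 f

/-- The average of the blocks. -/
def avg {N d : ℕ} (x : Stack N d) : Vec d := (1 / (N : ℝ)) • ∑ i, x i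

/-- The nonnegative orthant. -/
def orthant (m : ℕ) : Set (Vec m) := {v | ∀ k, 0 ≤ v k}

/-- The product of the sets `S i`. -/
def prodSet {N d : ℕ} (S : Fin N → Set (Vec d)) : Set (Stack N d) := {x | ∀ i, x i ∈ S i}

/-- The normal cone operator: empty off `S`, `{v | ⟪v, z - x⟫ ≤ 0 for all z ∈ S}` on `S`. -/
def normalCone {E : Type*} [NormedAddCommGroup E] [InnerProductSpace ℝ E] (S : Set E) (x : E) :
    Set E :=
  {v | x ∈ S ∧ ∀ z ∈ S, inner ℝ v (z - x) ≤ 0}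

/-- The projection onto `S`: a point of `S` nearest to `x` (unique if `S` is nonempty, closed
and convex). -/
def proj {d : ℕ} (S : Set (Vec d)) (x : Vec d) : Vec d :=
  Classical.epsilon fun y => y ∈ S ∧ ∀ z ∈ S, ‖y - x‖ ≤ ‖z - x‖

/-- The data of an aggregative game with `N` agents, strategies in `ℝ^n` and `m` affine coupling
constraints: costs `J_i(x_i, x̄)`, local sets `Ω_i`, matrices `C_i ∈ ℝ^{m×n}` (as linear maps; the
operator norm is the largest singular value and the adjoint is the transpose) and `c_i ∈ ℝ^m`. -/
structure AggGame (N n m : ℕ) where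
  J : Fin N → Vec n → Vec n → ℝ
  Ω : Fin N → Set (Vec n)
  C : Fin N → (Vec n →L[ℝ] Vec m)
  c : Fin N → Vec m

namespace AggGame

variable {N n m : ℕ} (g : AggGame N n m)

/-- `C x - c = ∑_i (C_i x_i - c_i)`. -/
def coupling (x : Stack N n) : Vec m := ∑ i, (g.C i (x i) - g.c i)

/-- The global feasible set `K`. -/
def feasible : Set (Stack N n) := {x | x ∈ prodSet g.Ω ∧ ∀ k, g.coupling x k ≤ 0}

/-- `(1/N) ∑_{j ≠ i} x_j`. -/
def others (i : Fin N) (x : Stack N n) : Vec n :=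
  (1 / (N : ℝ)) • ∑ j ∈ Finset.univ.erase i, x j

/-- The cost `z ↦ J_i(z, z/N + u)` of agent `i` as a function of its own strategy. -/
def ownCost (i : Fin N) (u : Vec n) (z : Vec n) : ℝ := g.J i z ((1 / (N : ℝ)) • z + u)

/-- `(z, x_{-i})`. -/
def deviate (i : Fin N) (x : Stack N n) (z : Vec n) : Stack N n :=
  col (Function.update (fun j => x j) i z)

/-- Generalized Nash equilibrium. -/
def IsGNE (x : Stack N n) : Prop :=
  x ∈ g.feasible ∧ ∀ i, ∀ z, deviate i x z ∈ g.feasible →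
    g.J i (x i) (avg x) ≤ g.J i z ((1 / (N : ℝ)) • z + others i x)

/-- The pseudo-gradient `F(x) = col(∇_{x_i} J_i(x_i, x̄))`; here `x̄` depends on `x_i`, too. -/
def pseudoGrad (x : Stack N n) : Stack N n :=
  col fun i => gradient (g.ownCost i (others i x)) (x i)

/-- The KKT system of the coupled problems, with multiplier `l i` for agent `i`. -/
def IsKKT (x : Stack N n) (l : Stack N m) : Prop :=
  ∀ i, (∃ v ∈ normalCone (g.Ω i) (x i),
      g.pseudoGrad x i + v + (g.C i).adjoint (l i) = 0) ∧
    l i ∈ orthant m ∧ (∀ k, g.coupling x k ≤ 0) ∧ inner ℝ (l i) (g.coupling x) = 0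

/-- Variational GNE: a GNE that satisfies the KKT system with equal multipliers. -/
def IsVariationalGNE (x : Stack N n) : Prop :=
  g.IsGNE x ∧ ∃ μ : Vec m, g.IsKKT x (col fun _ => μ)

/-- The map `F_i(v, w) = ∂J_i/∂z_1 (v, w) + (1/N) ∂J_i/∂z_2 (v, w)`. -/
def partialGrad (i : Fin N) (v w : Vec n) : Vec n :=
  gradient (fun z => g.J i z w) v + (1 / (N : ℝ)) • gradient (fun z => g.J i v z) w

/-- The extended pseudo-gradient `col(F_i(v_i, w_i))`. -/
def extPseudoGrad (v w : Stack N n) : Stack N n := col fun i => g.partialGrad i (v i) (w i)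

/-- The convex hull `Ω̄` of the union of the local sets. -/
def hull : Set (Vec n) := convexHull ℝ (⋃ i, g.Ω i)

/-- Convexity, compactness, smoothness and Slater's condition. -/
structure Standard : Prop where
  nonempty : ∀ i, (g.Ω i).Nonempty
  compact : ∀ i, IsCompact (g.Ω i)
  convex : ∀ i, Convex ℝ (g.Ω i)
  cost_convex : ∀ i, ∀ x ∈ prodSet g.Ω, ConvexOn ℝ (g.Ω i) (g.ownCost i (others i x))
  cost_diff : ∀ i, ∀ x ∈ prodSet g.Ω, ∀ z ∈ g.Ω i,
    DifferentiableAt ℝ (g.ownCost i (others i x)) z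
  cost_grad_cont : ∀ i, ∀ x ∈ prodSet g.Ω,
    ContinuousOn (gradient (g.ownCost i (others i x))) (g.Ω i)
  /-- `J_i` is differentiable in both arguments jointly, so that `F_i` is given by the partial
  gradients and `F_i(x_i, x̄) = ∇_{x_i} J_i(x_i, x̄)` by the chain rule. -/
  joint_diff : ∀ i, ∀ v ∈ g.Ω i, ∀ w ∈ g.hull,
    DifferentiableAt ℝ (fun p : Vec n × Vec n => g.J i p.1 p.2) (v, w)
  slater : ∃ x ∈ prodSet g.Ω, ∀ k, g.coupling x k < 0

/-- `F` is `χ`-cocoercive over the product of the local sets. -/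
def Cocoercive (χ : ℝ) : Prop :=
  ∀ x ∈ prodSet g.Ω, ∀ y ∈ prodSet g.Ω,
    χ * ‖g.pseudoGrad x - g.pseudoGrad y‖ ^ 2 ≤ inner ℝ (g.pseudoGrad x - g.pseudoGrad y) (x - y)

/-- The extended pseudo-gradient is Lipschitz when its first argument ranges over `∏ Ω_i` and each
block of its second argument ranges over `S`. -/
def LipschitzOver (S : Set (Vec n)) : Prop :=
  ∃ L : ℝ, 0 < L ∧ ∀ v ∈ prodSet g.Ω, ∀ u ∈ prodSet g.Ω,
    ∀ w ∈ prodSet (fun _ : Fin N => S), ∀ z ∈ prodSet (fun _ : Fin N => S),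
      ‖g.extPseudoGrad v w - g.extPseudoGrad u z‖ ≤ L * √(‖v - u‖ ^ 2 + ‖w - z‖ ^ 2)

/-- The set-valued operator `T`. Blockwise, `(C_fᵀ λ)_i = C_iᵀ ∑_j λ_j`,
`(C_f x - c_f)_i = C x - c` and `(L_m λ)_i = λ_i - λ̄`. -/
def T (x : Stack N n) (l : Stack N m) : Set (Stack N n × Stack N m) :=
  {p | ∃ a ∈ normalCone (prodSet g.Ω) x, ∃ b ∈ normalCone (prodSet fun _ : Fin N => orthant m) l,
    p.1 = a + g.pseudoGrad x + (1 / (N : ℝ)) • col (fun i => (g.C i).adjoint (∑ j, l j)) ∧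
    p.2 = b + col (fun i => l i - avg l) - (1 / (N : ℝ)) • col (fun _ => g.coupling x)}

/-- `col(x, λ) ∈ zer(T)`. -/
def IsZeroT (x : Stack N n) (l : Stack N m) : Prop := (0, 0) ∈ g.T x l

/-- The step sizes `α_i`, `β_i`, given the cocoercivity constant `χ`. -/
structure StepSizes (χ δ τ : ℝ) (α β : Fin N → ℝ) : Prop where
  δ_pos : 0 < δ
  δ_le : δ ≤ min 1 χ
  τ_gt : 1 / (2 * δ) < τ
  α_pos : ∀ i, 0 < α i
  α_le : ∀ i, α i ≤ (‖g.C i‖ + τ)⁻¹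
  β_pos : ∀ i, 0 < β i
  β_le : ∀ i, β i ≤ (1 / (N : ℝ) * ∑ j, ‖g.C j‖ + τ)⁻¹

end AggGame

/-- `Q`-connected sequence of undirected graphs. -/
def QConnected {N : ℕ} (G : ℕ → SimpleGraph (Fin N)) : Prop :=
  ∃ Q : ℕ, 1 ≤ Q ∧ ∀ k, (⨆ ℓ ∈ Finset.Icc 1 Q, G (ℓ + k)).Connected

/-- Mixing matrices for the graphs `G k`, with the lower bound `ε` uniform in `k`. -/
def IsMixing {N : ℕ} (G : ℕ → SimpleGraph (Fin N)) (W : ℕ → Matrix (Fin N) (Fin N) ℝ) : Prop :=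
  ∃ ε : ℝ, 0 < ε ∧ ∀ k,
    (∀ i j, i ≠ j → ((G k).Adj i j → ε ≤ W k i j) ∧ (¬ (G k).Adj i j → W k i j = 0)) ∧
    (∀ i, ε < W k i i) ∧
    (∀ i, ∑ j, W k i j = 1) ∧ (∀ j, ∑ i, W k i j = 1)

/-- Non-increasing in `[0,1]`, non-summable, square-summable relaxations. -/
structure VanishingSteps (γ : ℕ → ℝ) : Prop where
  nonneg : ∀ k, 0 ≤ γ k
  anti : ∀ k, γ (k + 1) ≤ γ k
  le_one : ∀ k, γ k ≤ 1
  not_summable : ¬ Summable γ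
  sq_summable : Summable fun k => γ k ^ 2

/-- The variables of the distributed algorithm at stage `k`: `x^k`, `λ^k`, the estimates `σ^k`,
`y^k`, `z^k`, and the remembered `x^{k-1}` and `x̃^{k-1}`. -/
structure AlgState (N n m : ℕ) where
  x : Stack N n
  lam : Stack N m
  σ : Stack N n
  y : Stack N m
  z : Stack N m
  xPrev : Stack N n
  xtPrev : Stack N n

/-- Distributed averaging `v_i ↦ ∑_j w_{i,j} v_j`. -/
def mix {N d : ℕ} (w : Matrix (Fin N) (Fin N) ℝ) (v : Stack N d) : Stack N d :=
  col fun i => ∑ j, w i j • v j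

namespace AggGame

variable {N n m : ℕ} (g : AggGame N n m)

/-- Initialization from `x^{-1}`, `x̃^{-1}`, `x^0`, `λ^0`. -/
def algInit (xm xtm x0 : Stack N n) (l0 : Stack N m) : AlgState N n m where
  x := x0
  lam := l0
  σ := x0
  y := col fun i => (2 : ℝ) • g.C i (xtm i) - g.C i (xm i) - g.c i
  z := l0
  xPrev := xm
  xtPrev := xtm

/-- One iteration, with step sizes `α`, `β`, mixing matrix `w` and relaxation `γ`. -/
def algStep (α β : Fin N → ℝ) (w : Matrix (Fin N) (Fin N) ℝ) (γ : ℝ) (s : AlgState N n m) :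
    AlgState N n m :=
  let σh := mix w s.σ
  let yh := mix w s.y
  let zh := mix w s.z
  let xt : Stack N n := col fun i =>
    proj (g.Ω i) (s.x i - α i • (g.partialGrad i (s.x i) (σh i) + (g.C i).adjoint (zh i)))
  let y' : Stack N m := col fun i =>
    yh i + g.C i ((2 : ℝ) • xt i - s.x i) - g.C i ((2 : ℝ) • s.xtPrev i - s.xPrev i)
  let lt : Stack N m := col fun i =>
    proj (orthant m) (s.lam i + β i • (y' i - s.lam i + zh i))
  let x' := s.x + γ • (xt - s.x)
  let l' := s.lam + γ • (lt - s.lam)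
  { x := x', lam := l', σ := σh + x' - s.x, y := y', z := zh + l' - s.lam,
    xPrev := s.x, xtPrev := xt }

/-- The sequence generated by the fully distributed algorithm. -/
def alg (α β : Fin N → ℝ) (W : ℕ → Matrix (Fin N) (Fin N) ℝ) (γ : ℕ → ℝ)
    (xm xtm x0 : Stack N n) (l0 : Stack N m) : ℕ → AlgState N n m
  | 0 => g.algInit xm xtm x0 l0
  | k + 1 => g.algStep α β (W k) (γ k) (alg α β W γ xm xtm x0 l0 k)

end AggGame

end

/-! The iterates `(x^k, λ^k)` follow a relaxed preconditioned forward-backward iteration for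
`0 ∈ T`, with an error caused by replacing averages with the tracking variables `σ`, `y`, `z`.
Mixing contracts disagreement geometrically and the increments of the iterates are `O(γ^k)`, so the
errors are summable with weights `γ^k`. Boundedness then produces a zero of `T` without assuming
that one exists: the `γ`-weighted averages of the iterates cluster at a weak solution, which is a
solution by Minty's argument. The iterates are quasi-Fejér monotone with respect to it, and hence
converge.

The Lipschitz bound needs `σ̂^k` to lie in the convex hull of the strategy sets. When `γ^0 < 1`
this holds for large `k`, because `σ̂^k` responds linearly to the past points `x̃` and these
responses eventually have nonnegative entries. When `γ^0 = 1`, the tracking error tends to zero and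
the assumed neighbourhood of the hull suffices. -/

section Sequences

theorem summable_of_quasiFejer {a b c : ℕ → ℝ} (ha : ∀ k, 0 ≤ a k) (hb : ∀ k, 0 ≤ b k)
    (hc : ∀ k, 0 ≤ c k) (hcs : Summable c) (h : ∀ k, a (k + 1) ≤ a k - b k + c k) :
    Summable b := by
  have htelescope : ∀ n, a n + ∑ k ∈ Finset.range n, b k ≤ a 0 + ∑ k ∈ Finset.range n, c k := by
    intro n
    induction n with
    | zero => simp
    | succ n ih =>
      rw [Finset.sum_range_succ, Finset.sum_range_succ]
      linarith [h n]
  refine summable_of_sum_range_le (c := a 0 + ∑' k, c k) hb fun n => ?_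
  linarith [htelescope n, ha n, hcs.sum_le_tsum (Finset.range n) fun k _ => hc k]

theorem exists_tendsto_of_le_add_summable {a c : ℕ → ℝ} (ha : ∀ k, 0 ≤ a k)
    (hc : ∀ k, 0 ≤ c k) (hcs : Summable c) (h : ∀ k, a (k + 1) ≤ a k + c k) :
    ∃ l, Tendsto a atTop (𝓝 l) := by
  have hanti : Antitone fun k => a k - ∑ j ∈ Finset.range k, c j :=
    antitone_nat_of_succ_le fun k => by
      rw [Finset.sum_range_succ]
      linarith [h k]
  have hbdd : BddBelow (Set.range fun k => a k - ∑ j ∈ Finset.range k, c j) := by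
    refine ⟨-∑' j, c j, Set.forall_mem_range.2 fun k => ?_⟩
    linarith [ha k, hcs.sum_le_tsum (Finset.range k) fun j _ => hc j]
  have hlim := (tendsto_atTop_ciInf hanti hbdd).add hcs.hasSum.tendsto_sum_nat
  exact ⟨_, by simpa only [sub_add_cancel] using hlim⟩

theorem frequently_lt_of_summable_mul {γ f : ℕ → ℝ} (hγ : ∀ k, 0 ≤ γ k) (hns : ¬ Summable γ)
    (hs : Summable fun k => γ k * f k) {ε : ℝ} (hε : 0 < ε) : ∃ᶠ k in atTop, f k < ε := by
  intro hge
  refine hns (Summable.of_norm_bounded_eventually_nat (hs.div_const ε) ?_)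
  filter_upwards [hge] with k hk
  rw [Real.norm_of_nonneg (hγ k), le_div_iff₀ hε]
  exact mul_le_mul_of_nonneg_left (not_lt.mp hk) (hγ k)

theorem exists_subseq_tendsto_zero_of_summable_mul {γ f : ℕ → ℝ} (hγ : ∀ k, 0 ≤ γ k)
    (hns : ¬ Summable γ) (hf : ∀ k, 0 ≤ f k) (hs : Summable fun k => γ k * f k) :
    ∃ φ : ℕ → ℕ, StrictMono φ ∧ Tendsto (f ∘ φ) atTop (𝓝 0) := by
  obtain ⟨φ, hφ, hlt⟩ := extraction_forall_of_frequently fun n : ℕ =>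
    frequently_lt_of_summable_mul hγ hns hs (ε := 1 / ((n : ℝ) + 1)) (by positivity)
  exact ⟨φ, hφ, squeeze_zero (fun n => hf _) (fun n => (hlt n).le)
    tendsto_one_div_add_atTop_nhds_zero_nat⟩

variable {ρ : ℝ} {a h : ℕ → ℝ}

theorem bddAbove_of_contraction (hρ : 0 ≤ ρ) (hρ1 : ρ < 1)
    (hah : ∀ k, a (k + 1) ≤ ρ * a k + h k) (hh : BddAbove (Set.range h)) :
    BddAbove (Set.range a) := by
  obtain ⟨B, hB⟩ := hh
  have h1ρ : 0 < 1 - ρ := sub_pos.2 hρ1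
  set M := max (a 0) (B / (1 - ρ))
  have hBM : B ≤ (1 - ρ) * M := (div_le_iff₀' h1ρ).1 (le_max_right _ _)
  refine ⟨M, Set.forall_mem_range.2 fun k => ?_⟩
  induction k with
  | zero => exact le_max_left _ _
  | succ k ih =>
    linarith [hah k, hB ⟨k, rfl⟩, mul_le_mul_of_nonneg_left ih hρ]

theorem summable_of_contraction (hρ1 : ρ < 1) (ha : ∀ k, 0 ≤ a k)
    (hah : ∀ k, a (k + 1) ≤ ρ * a k + h k) (hh : ∀ k, 0 ≤ h k) (hhs : Summable h) :
    Summable a := by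
  have h1ρ : 0 < 1 - ρ := sub_pos.2 hρ1
  refine (summable_mul_left_iff h1ρ.ne').1 (summable_of_quasiFejer ha
    (fun k => mul_nonneg h1ρ.le (ha k)) hh hhs fun k => ?_)
  linarith [hah k]

theorem tendsto_zero_of_contraction (hρ : 0 ≤ ρ) (hρ1 : ρ < 1) (ha : ∀ k, 0 ≤ a k)
    (hah : ∀ k, a (k + 1) ≤ ρ * a k + h k) (hh : Tendsto h atTop (𝓝 0)) :
    Tendsto a atTop (𝓝 0) := by
  refine tendsto_order.2 ⟨fun ε hε => Eventually.of_forall fun k => hε.trans_le (ha k),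
    fun ε hε => ?_⟩
  obtain ⟨K, hK⟩ := eventually_atTop.1
    (hh.eventually_lt_const (mul_pos (sub_pos.2 hρ1) (half_pos hε)))
  have hdecay : ∀ t, a (t + K) ≤ ρ ^ t * a K + ε / 2 := by
    intro t
    induction t with
    | zero => simpa using (half_pos hε).le
    | succ t ih =>
      rw [add_right_comm, pow_succ]
      linarith [hah (t + K), hK (t + K) (by omega), mul_le_mul_of_nonneg_left ih hρ]
  have hpow : Tendsto (fun t => ρ ^ t * a K) atTop (𝓝 0) := by
    simpa using (tendsto_pow_atTop_nhds_zero_of_lt_one hρ hρ1).mul_const (a K)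
  rw [← map_add_atTop_eq_nat K, eventually_map]
  filter_upwards [hpow.eventually_lt_const (half_pos hε)] with t ht
  linarith [hdecay t]

/-- The convolution `k ↦ ∑_{r < k} ρ^{k - 1 - r} f r`, which solves `a (k + 1) = ρ a k + f k`,
`a 0 = 0`. -/
def geomConv (ρ : ℝ) (f : ℕ → ℝ) (k : ℕ) : ℝ := ∑ r ∈ Finset.range k, ρ ^ (k - 1 - r) * f r

theorem geomConv_zero (ρ : ℝ) (f : ℕ → ℝ) : geomConv ρ f 0 = 0 := by simp [geomConv]

theorem geomConv_succ (ρ : ℝ) (f : ℕ → ℝ) (k : ℕ) :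
    geomConv ρ f (k + 1) = ρ * geomConv ρ f k + f k := by
  have hpow : ∀ r ∈ Finset.range k, ρ ^ (k + 1 - 1 - r) * f r = ρ * (ρ ^ (k - 1 - r) * f r) := by
    intro r hr
    rw [Finset.mem_range] at hr
    rw [show k + 1 - 1 - r = (k - 1 - r) + 1 by omega, pow_succ', mul_assoc]
  rw [geomConv, Finset.sum_range_succ, Finset.sum_congr rfl hpow, ← Finset.mul_sum, geomConv]
  simp

theorem geomConv_nonneg (hρ : 0 ≤ ρ) {f : ℕ → ℝ} (hf : ∀ k, 0 ≤ f k) (k : ℕ) :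
    0 ≤ geomConv ρ f k :=
  Finset.sum_nonneg fun r _ => mul_nonneg (pow_nonneg hρ _) (hf r)

theorem geomConv_shift_le (hρ : 0 ≤ ρ) {f : ℕ → ℝ} (hf : ∀ k, 0 ≤ f k) (j t : ℕ) :
    geomConv ρ (fun r => f (j + r)) t ≤ geomConv ρ f (j + t) := by
  induction t with
  | zero =>
    rw [geomConv_zero]
    exact geomConv_nonneg hρ hf _
  | succ t ih =>
    rw [← add_assoc, geomConv_succ, geomConv_succ]
    gcongr

theorem tendsto_geomConv (hρ : 0 ≤ ρ) (hρ1 : ρ < 1) {f : ℕ → ℝ} (hf : ∀ k, 0 ≤ f k)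
    (hf0 : Tendsto f atTop (𝓝 0)) : Tendsto (geomConv ρ f) atTop (𝓝 0) :=
  tendsto_zero_of_contraction hρ hρ1 (geomConv_nonneg hρ hf)
    (fun k => (geomConv_succ ρ f k).le) hf0

end Sequences

section ForwardBackward

theorem mem_of_relaxation {E : Type*} [AddCommGroup E] [Module ℝ E] {D : Set E}
    (hD : Convex ℝ D) {γ : ℕ → ℝ} (h0 : ∀ k, 0 ≤ γ k) (h1 : ∀ k, γ k ≤ 1) {w wt : ℕ → E}
    (hw0 : w 0 ∈ D) (hwt : ∀ k, wt k ∈ D) (hw : ∀ k, w (k + 1) = w k + γ k • (wt k - w k))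
    (k : ℕ) : w k ∈ D := by
  induction k with
  | zero => exact hw0
  | succ k ih => exact hw k ▸ hD.add_smul_sub_mem ih (hwt k) ⟨h0 k, h1 k⟩

theorem tendsto_zero_of_mul_norm_sq_le {E : Type*} [SeminormedAddCommGroup E] {u : ℕ → E}
    {b : ℕ → ℝ} {c : ℝ} (hc : 0 < c) (hub : ∀ n, c * ‖u n‖ ^ 2 ≤ b n)
    (hb : Tendsto b atTop (𝓝 0)) : Tendsto u atTop (𝓝 0) := by
  have hsq : Tendsto (fun n => ‖u n‖ ^ 2) atTop (𝓝 0) := by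
    refine squeeze_zero (fun n => sq_nonneg _) (fun n => (le_div_iff₀' hc).2 (hub n)) ?_
    simpa only [zero_div] using hb.div_const c
  refine tendsto_zero_iff_norm_tendsto_zero.2 ?_
  simpa only [Real.sqrt_sq (norm_nonneg _), Real.sqrt_zero] using hsq.sqrt

variable {E : Type*} [NormedAddCommGroup E] [InnerProductSpace ℝ E]

/-- `B` is `δ`-cocoercive on `D`. -/
def IsCocoerciveOn (δ : ℝ) (B : E → E) (D : Set E) : Prop :=
  ∀ x ∈ D, ∀ y ∈ D, δ * ‖B x - B y‖ ^ 2 ≤ inner ℝ (B x - B y) (x - y)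

namespace IsCocoerciveOn

variable {D : Set E} {B : E → E} {δ : ℝ}

theorem lipschitzOnWith (hB : IsCocoerciveOn δ B D) (hδ : 0 < δ) :
    LipschitzOnWith (Real.toNNReal (1 / δ)) B D := by
  refine LipschitzOnWith.of_dist_le_mul fun x hx y hy => ?_
  rw [Real.coe_toNNReal _ (by positivity), dist_eq_norm, dist_eq_norm, one_div_mul_eq_div,
    le_div_iff₀ hδ]
  rcases (norm_nonneg (B x - B y)).eq_or_lt with h0 | hpos
  · simp [← h0]
  · refine le_of_mul_le_mul_right ?_ hpos
    calc ‖B x - B y‖ * δ * ‖B x - B y‖ = δ * ‖B x - B y‖ ^ 2 := by ring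
      _ ≤ inner ℝ (B x - B y) (x - y) := hB x hx y hy
      _ ≤ ‖x - y‖ * ‖B x - B y‖ := (real_inner_le_norm _ _).trans_eq (mul_comm _ _)

theorem neg_mul_norm_sub_sq_le_inner (hB : IsCocoerciveOn δ B D) (hδ : 0 < δ) {w v : E}
    (hw : w ∈ D) (hv : v ∈ D) (z : E) :
    -(1 / (4 * δ) * ‖w - z‖ ^ 2) ≤ inner ℝ (B w - B v) (z - v) := by
  have hcoc := hB w hw v hv
  rw [← sub_add_sub_cancel w z v, inner_add_right] at hcoc
  have hCS := real_inner_le_norm (B w - B v) (w - z)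
  have hyoung : δ * ‖B w - B v‖ ^ 2 + 1 / (4 * δ) * ‖w - z‖ ^ 2 - ‖B w - B v‖ * ‖w - z‖
      = δ * (‖B w - B v‖ - 1 / (2 * δ) * ‖w - z‖) ^ 2 := by
    field_simp
    ring
  have hsq : 0 ≤ δ * (‖B w - B v‖ - 1 / (2 * δ) * ‖w - z‖) ^ 2 := by positivity
  linarith

end IsCocoerciveOn

/-- Minty's lemma. -/
theorem neg_mem_normalCone_of_forall_inner_le {D : Set E} (hconv : Convex ℝ D) {H : E → E}
    (hH : ContinuousOn H D) {w : E} (hw : w ∈ D) (h : ∀ v ∈ D, inner ℝ (H v) (w - v) ≤ 0) :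
    -H w ∈ normalCone D w := by
  refine ⟨hw, fun ζ hζ => ?_⟩
  rw [inner_neg_left, neg_nonpos]
  set v : ℕ → E := fun n => w + (1 / ((n : ℝ) + 1)) • (ζ - w)
  have hvD : ∀ n, v n ∈ D := fun n => hconv.add_smul_sub_mem hw hζ
    ⟨by positivity, (div_le_one (by positivity)).2 (by linarith [n.cast_nonneg (α := ℝ)])⟩
  have hvw : Tendsto v atTop (𝓝 w) := by
    simpa only [zero_smul, add_zero] using
      ((tendsto_one_div_add_atTop_nhds_zero_nat (𝕜 := ℝ)).smul_const (ζ - w)).const_add w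
  have hHv : Tendsto (fun n => H (v n)) atTop (𝓝 (H w)) :=
    (hH w hw).tendsto.comp (tendsto_nhdsWithin_iff.2 ⟨hvw, Eventually.of_forall hvD⟩)
  refine ge_of_tendsto (hHv.inner tendsto_const_nhds) (Eventually.of_forall fun n => ?_)
  have hn := h _ (hvD n)
  rw [sub_add_cancel_left, inner_neg_right, real_inner_smul_right, neg_nonpos] at hn
  exact nonneg_of_mul_nonneg_right hn (by positivity)

/-- A monotone operator `B + A + N_D`, split into a cocoercive `B`, a skew `A` and a normal cone,
with a preconditioner `P` strong enough for explicit steps along `B`. -/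
structure IsPreconditionedSplitting (D : Set E) (P A : E →ₗ[ℝ] E) (B : E → E) (δ τ : ℝ) :
    Prop where
  isClosed : IsClosed D
  convex : Convex ℝ D
  δ_pos : 0 < δ
  τ_gt : 1 / (2 * δ) < τ
  isSymmetric : P.IsSymmetric
  coercive : ∀ x, τ * ‖x‖ ^ 2 ≤ inner ℝ (P x) x
  skew : ∀ x, inner ℝ (A x) x = 0
  cocoercive : IsCocoerciveOn δ B D

/-- Relaxed preconditioned forward-backward iteration `wt k = (P + A + N_D)⁻¹ (P - B) (w k)`, up to
the error `e k`. -/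
structure IsInexactForwardBackward (D : Set E) (P A : E →ₗ[ℝ] E) (B : E → E) (γ : ℕ → ℝ)
    (e w wt : ℕ → E) : Prop where
  init : w 0 ∈ D
  inclusion : ∀ k, P (w k - wt k) - B (w k) - A (wt k) - e k ∈ normalCone D (wt k)
  relax : ∀ k, w (k + 1) = w k + γ k • (wt k - w k)

theorem inner_map_relax_le {P : E →ₗ[ℝ] E} (hpos : ∀ x, 0 ≤ inner ℝ (P x) x) {t : ℝ}
    (h0 : 0 ≤ t) (h1 : t ≤ 1) (w wt v : E) :
    inner ℝ (P (w + t • (wt - w) - v)) (w + t • (wt - w) - v)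
      ≤ (1 - t) * inner ℝ (P (w - v)) (w - v) + t * inner ℝ (P (wt - v)) (wt - v) := by
  obtain ⟨a, ha⟩ : ∃ a, a = w - v := ⟨_, rfl⟩
  obtain ⟨d, hd⟩ : ∃ d, d = wt - v := ⟨_, rfl⟩
  have hcomb : w + t • (wt - w) - v = (1 - t) • a + t • d := by
    rw [ha, hd]
    module
  have hdefect : (1 - t) * inner ℝ (P a) a + t * inner ℝ (P d) d
      - inner ℝ (P ((1 - t) • a + t • d)) ((1 - t) • a + t • d)
      = t * (1 - t) * inner ℝ (P (a - d)) (a - d) := by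
    simp only [map_add, map_sub, map_smul, inner_add_left, inner_add_right, inner_sub_left,
      inner_sub_right, real_inner_smul_left, real_inner_smul_right]
    ring
  rw [hcomb, ← ha, ← hd]
  linarith [mul_nonneg (mul_nonneg h0 (sub_nonneg.2 h1)) (hpos (a - d))]

namespace IsPreconditionedSplitting

variable {D : Set E} {P A : E →ₗ[ℝ] E} {B : E → E} {δ τ : ℝ}
  (hS : IsPreconditionedSplitting D P A B δ τ)
include hS

theorem τ_pos : 0 < τ := (one_div_pos.2 (mul_pos two_pos hS.δ_pos)).trans hS.τ_gt

theorem inner_map_self_nonneg (x : E) : 0 ≤ inner ℝ (P x) x :=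
  (mul_nonneg hS.τ_pos.le (sq_nonneg ‖x‖)).trans (hS.coercive x)

theorem continuousOn : ContinuousOn B D := (hS.cocoercive.lipschitzOnWith hS.δ_pos).continuousOn

theorem inner_map_resolvent_le {w wt v e : E} (hw : w ∈ D) (hv : v ∈ D)
    (hwt : P (w - wt) - B w - A wt - e ∈ normalCone D wt) :
    inner ℝ (P (wt - v)) (wt - v) ≤ inner ℝ (P (w - v)) (w - v)
      - (τ - 1 / (2 * δ)) * ‖w - wt‖ ^ 2 - 2 * inner ℝ (B v + A v) (wt - v)
      + 2 * (‖e‖ * ‖wt - v‖) := by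
  have hcone := hwt.2 v hv
  have hcoc := hS.cocoercive.neg_mul_norm_sub_sq_le_inner hS.δ_pos hw hv wt
  have hskew := hS.skew (wt - v)
  have hcoer := hS.coercive (w - wt)
  have hsymm : inner ℝ (P (wt - v)) (w - wt) = inner ℝ (P (w - wt)) (wt - v) := by
    rw [hS.isSymmetric, real_inner_comm]
  have herr := (abs_le.1 (abs_real_inner_le_norm e (wt - v))).1
  have hδ : 1 / (2 * δ) = 2 * (1 / (4 * δ)) := by ring
  rw [← neg_sub wt v, inner_neg_right, inner_sub_left, inner_sub_left, inner_sub_left] at hcone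
  rw [map_sub, inner_sub_left] at hskew
  rw [inner_sub_left] at hcoc
  rw [← sub_add_sub_cancel w wt v, map_add, inner_add_left, inner_add_right, inner_add_right,
    inner_add_left (B v), hδ]
  linarith

end IsPreconditionedSplitting

namespace IsInexactForwardBackward

variable {D : Set E} {P A : E →ₗ[ℝ] E} {B : E → E} {δ τ M : ℝ} {γ : ℕ → ℝ} {e w wt : ℕ → E}

theorem mem (h : IsInexactForwardBackward D P A B γ e w wt) (hconv : Convex ℝ D)
    (h0 : ∀ k, 0 ≤ γ k) (h1 : ∀ k, γ k ≤ 1) (k : ℕ) : w k ∈ D :=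
  mem_of_relaxation hconv h0 h1 h.init (fun k => (h.inclusion k).1) h.relax k

variable (h : IsInexactForwardBackward D P A B γ e w wt)
  (hS : IsPreconditionedSplitting D P A B δ τ) (h0 : ∀ k, 0 ≤ γ k) (h1 : ∀ k, γ k ≤ 1)
  (hM : ∀ k, ‖wt k‖ ≤ M)
include h hS h0 h1 hM

theorem descent {v : E} (hv : v ∈ D) (k : ℕ) :
    inner ℝ (P (w (k + 1) - v)) (w (k + 1) - v)
      ≤ inner ℝ (P (w k - v)) (w k - v) - γ k * ((τ - 1 / (2 * δ)) * ‖w k - wt k‖ ^ 2)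
        - 2 * (γ k * inner ℝ (B v + A v) (wt k - v)) + 2 * (M + ‖v‖) * (γ k * ‖e k‖) := by
  have hrelax := inner_map_relax_le hS.inner_map_self_nonneg (h0 k) (h1 k) (w k) (wt k) v
  rw [← h.relax] at hrelax
  have hstep := mul_le_mul_of_nonneg_left
    (hS.inner_map_resolvent_le (h.mem hS.convex h0 h1 k) hv (h.inclusion k)) (h0 k)
  have hdist : ‖wt k - v‖ ≤ M + ‖v‖ := (norm_sub_le _ _).trans (by gcongr; exact hM k)
  have herr := mul_le_mul_of_nonneg_left hdist (mul_nonneg (h0 k) (norm_nonneg (e k)))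
  linarith

variable (he : Summable fun k => γ k * ‖e k‖)
include he

theorem sum_mul_inner_le {v : E} (hv : v ∈ D) (n : ℕ) :
    2 * ∑ k ∈ Finset.range n, γ k * inner ℝ (B v + A v) (wt k - v)
      ≤ inner ℝ (P (w 0 - v)) (w 0 - v) + 2 * (M + ‖v‖) * ∑' k, γ k * ‖e k‖ := by
  have htelescope : inner ℝ (P (w n - v)) (w n - v)
      + 2 * ∑ k ∈ Finset.range n, γ k * inner ℝ (B v + A v) (wt k - v)
      ≤ inner ℝ (P (w 0 - v)) (w 0 - v)
        + 2 * (M + ‖v‖) * ∑ k ∈ Finset.range n, γ k * ‖e k‖ := by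
    induction n with
    | zero => simp
    | succ n ih =>
      rw [Finset.sum_range_succ, Finset.sum_range_succ]
      linarith [h.descent hS h0 h1 hM hv n, mul_nonneg (h0 n)
        (mul_nonneg (sub_nonneg.2 hS.τ_gt.le) (sq_nonneg ‖w n - wt n‖))]
  have hM0 : 0 ≤ M := (norm_nonneg _).trans (hM 0)
  have hesum : ∑ k ∈ Finset.range n, γ k * ‖e k‖ ≤ ∑' k, γ k * ‖e k‖ :=
    he.sum_le_tsum _ fun k _ => mul_nonneg (h0 k) (norm_nonneg _)
  linarith [hS.inner_map_self_nonneg (w n - v),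
    mul_le_mul_of_nonneg_left hesum (by positivity : 0 ≤ 2 * (M + ‖v‖))]

theorem inner_centerMass_sub_le {v : E} (hv : v ∈ D) {n : ℕ}
    (hn : 0 < ∑ k ∈ Finset.range n, γ k) :
    inner ℝ (B v + A v) ((Finset.range n).centerMass γ wt - v)
      ≤ (inner ℝ (P (w 0 - v)) (w 0 - v) + 2 * (M + ‖v‖) * ∑' k, γ k * ‖e k‖) / 2
        / ∑ k ∈ Finset.range n, γ k := by
  have hcenter : (∑ k ∈ Finset.range n, γ k) • ((Finset.range n).centerMass γ wt - v)
      = ∑ k ∈ Finset.range n, γ k • (wt k - v) := by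
    simp only [Finset.centerMass, smul_sub, smul_inv_smul₀ hn.ne', Finset.sum_smul,
      Finset.sum_sub_distrib]
  rw [le_div_iff₀' hn, ← real_inner_smul_right, hcenter, inner_sum]
  simp only [real_inner_smul_right]
  linarith [h.sum_mul_inner_le hS h0 h1 hM he hv n]

theorem exists_tendsto_and_summable {v : E} (hv : -(B v + A v) ∈ normalCone D v) :
    (∃ l, Tendsto (fun k => inner ℝ (P (w k - v)) (w k - v)) atTop (𝓝 l)) ∧
      Summable fun k => γ k * ((τ - 1 / (2 * δ)) * ‖w k - wt k‖ ^ 2) := by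
  have hM0 : 0 ≤ M := (norm_nonneg _).trans (hM 0)
  have hgap : ∀ k, 0 ≤ γ k * ((τ - 1 / (2 * δ)) * ‖w k - wt k‖ ^ 2) := fun k =>
    mul_nonneg (h0 k) (mul_nonneg (sub_nonneg.2 hS.τ_gt.le) (sq_nonneg _))
  have herr : ∀ k, 0 ≤ 2 * (M + ‖v‖) * (γ k * ‖e k‖) := fun k =>
    mul_nonneg (by positivity) (mul_nonneg (h0 k) (norm_nonneg _))
  have hdesc : ∀ k, inner ℝ (P (w (k + 1) - v)) (w (k + 1) - v)
      ≤ inner ℝ (P (w k - v)) (w k - v) - γ k * ((τ - 1 / (2 * δ)) * ‖w k - wt k‖ ^ 2)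
        + 2 * (M + ‖v‖) * (γ k * ‖e k‖) := fun k => by
    have hvi := hv.2 _ (h.inclusion k).1
    rw [inner_neg_left, neg_nonpos] at hvi
    linarith [h.descent hS h0 h1 hM hv.1 k, mul_nonneg (h0 k) hvi]
  exact ⟨exists_tendsto_of_le_add_summable (fun k => hS.inner_map_self_nonneg (w k - v)) herr
      (he.mul_left _) fun k => (hdesc k).trans (by linarith [hgap k]),
    summable_of_quasiFejer (fun k => hS.inner_map_self_nonneg (w k - v)) hgap herr
      (he.mul_left _) hdesc⟩

variable [FiniteDimensional ℝ E] (hγ : ¬ Summable γ)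
include hγ

/-- The `γ`-weighted averages of the `wt k` cluster at a weak solution. -/
theorem exists_neg_mem_normalCone : ∃ v, -(B v + A v) ∈ normalCone D v := by
  have := FiniteDimensional.proper ℝ E
  have hdiv : Tendsto (fun n => ∑ k ∈ Finset.range n, γ k) atTop atTop :=
    (not_summable_iff_tendsto_nat_atTop_of_nonneg h0).1 hγ
  have hcomp : IsCompact (D ∩ Metric.closedBall 0 M) :=
    (isCompact_closedBall 0 M).inter_left hS.isClosed
  have hmem : ∀ᶠ n in atTop, (Finset.range n).centerMass γ wt ∈ D ∩ Metric.closedBall 0 M := by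
    filter_upwards [hdiv.eventually_gt_atTop 0] with n hn
    exact (hS.convex.inter (convex_closedBall 0 M)).centerMass_mem (fun k _ => h0 k) hn
      fun k _ => ⟨(h.inclusion k).1, mem_closedBall_zero_iff.2 (hM k)⟩
  obtain ⟨v, hv, φ, hφ, hlim⟩ := hcomp.tendsto_subseq' hmem.frequently
  have hcont : ContinuousOn (fun u => B u + A u) D :=
    hS.continuousOn.add A.continuous_of_finiteDimensional.continuousOn
  refine ⟨v, neg_mem_normalCone_of_forall_inner_le hS.convex hcont hv.1 fun u hu => ?_⟩
  have hdivφ := hdiv.comp hφ.tendsto_atTop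
  exact le_of_tendsto_of_tendsto (tendsto_const_nhds.inner (hlim.sub_const u))
    (hdivφ.const_div_atTop _) ((hdivφ.eventually_gt_atTop 0).mono fun n hn =>
      h.inner_centerMass_sub_le hS h0 h1 hM he hu hn)

theorem exists_subseq_tendsto_zero :
    ∃ φ : ℕ → ℕ, StrictMono φ ∧ Tendsto (fun n => w (φ n) - wt (φ n)) atTop (𝓝 0) ∧
      Tendsto (fun n => e (φ n)) atTop (𝓝 0) := by
  obtain ⟨v, hv⟩ := h.exists_neg_mem_normalCone hS h0 h1 hM he hγ
  have hκ : 0 < τ - 1 / (2 * δ) := sub_pos.2 hS.τ_gt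
  have hgap : ∀ k, 0 ≤ (τ - 1 / (2 * δ)) * ‖w k - wt k‖ ^ 2 := fun k =>
    mul_nonneg hκ.le (sq_nonneg _)
  have hsum : Summable fun k => γ k * ((τ - 1 / (2 * δ)) * ‖w k - wt k‖ ^ 2 + ‖e k‖) := by
    simpa only [mul_add] using (h.exists_tendsto_and_summable hS h0 h1 hM he hv).2.add he
  obtain ⟨φ, hφ, hlim⟩ := exists_subseq_tendsto_zero_of_summable_mul h0 hγ
    (fun k => add_nonneg (hgap k) (norm_nonneg (e k))) hsum
  exact ⟨φ, hφ,
    tendsto_zero_of_mul_norm_sq_le hκ (fun n => le_add_of_nonneg_right (norm_nonneg _)) hlim,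
    squeeze_zero_norm (fun n => le_add_of_nonneg_left (hgap (φ n))) hlim⟩

theorem exists_subseq_tendsto_neg_mem_normalCone :
    ∃ ws, -(B ws + A ws) ∈ normalCone D ws ∧
      ∃ φ : ℕ → ℕ, StrictMono φ ∧ Tendsto (fun n => w (φ n)) atTop (𝓝 ws) := by
  have := FiniteDimensional.proper ℝ E
  obtain ⟨φ, hφ, hgap, herr⟩ := h.exists_subseq_tendsto_zero hS h0 h1 hM he hγ
  have hcomp : IsCompact (D ∩ Metric.closedBall 0 M) :=
    (isCompact_closedBall 0 M).inter_left hS.isClosed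
  obtain ⟨ws, hws, ψ, hψ, hwt⟩ := hcomp.tendsto_subseq (x := fun n => wt (φ n))
    fun n => ⟨(h.inclusion _).1, mem_closedBall_zero_iff.2 (hM _)⟩
  have hgap := hgap.comp hψ.tendsto_atTop
  have hw : Tendsto (fun n => w (φ (ψ n))) atTop (𝓝 ws) := by
    simpa [Function.comp_def] using hgap.add hwt
  refine ⟨ws, ⟨hws.1, fun ζ hζ => ?_⟩, φ ∘ ψ, hφ.comp hψ, hw⟩
  have hP : Tendsto (fun n => P (w (φ (ψ n)) - wt (φ (ψ n)))) atTop (𝓝 (P 0)) :=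
    (P.continuous_of_finiteDimensional.tendsto 0).comp hgap
  have hA : Tendsto (fun n => A (wt (φ (ψ n)))) atTop (𝓝 (A ws)) :=
    (A.continuous_of_finiteDimensional.tendsto ws).comp hwt
  have hB : Tendsto (fun n => B (w (φ (ψ n)))) atTop (𝓝 (B ws)) :=
    (hS.continuousOn ws hws.1).tendsto.comp
      (tendsto_nhdsWithin_iff.2 ⟨hw, Eventually.of_forall fun n => h.mem hS.convex h0 h1 _⟩)
  have hlim := (((hP.sub hB).sub hA).sub (herr.comp hψ.tendsto_atTop)).inner
    (hwt.const_sub ζ) (𝕜 := ℝ)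
  rw [map_zero, zero_sub, sub_zero, ← neg_add'] at hlim
  exact le_of_tendsto hlim (Eventually.of_forall fun n => (h.inclusion _).2 ζ hζ)

theorem exists_tendsto : ∃ ws, Tendsto w atTop (𝓝 ws) ∧ -(B ws + A ws) ∈ normalCone D ws := by
  obtain ⟨ws, hws, φ, hφ, hwφ⟩ :=
    h.exists_subseq_tendsto_neg_mem_normalCone hS h0 h1 hM he hγ
  refine ⟨ws, ?_, hws⟩
  obtain ⟨l, hl⟩ := (h.exists_tendsto_and_summable hS h0 h1 hM he hws).1
  have hquad : Continuous fun x => inner ℝ (P (x - ws)) (x - ws) :=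
    (P.continuous_of_finiteDimensional.comp (continuous_id.sub continuous_const)).inner
      (continuous_id.sub continuous_const)
  have hsub : Tendsto (fun n => inner ℝ (P (w (φ n) - ws)) (w (φ n) - ws)) atTop (𝓝 0) := by
    simpa [Function.comp_def] using (hquad.tendsto ws).comp hwφ
  obtain rfl := tendsto_nhds_unique (hl.comp hφ.tendsto_atTop) hsub
  exact tendsto_sub_nhds_zero_iff.1
    (tendsto_zero_of_mul_norm_sq_le hS.τ_pos (fun k => hS.coercive (w k - ws)) hl)

end IsInexactForwardBackward

end ForwardBackward

theorem eq_univ_of_card_lt_card {ι : Type*} [Fintype ι] {R : ℕ → Finset ι} {q : ℕ} (hR : Monotone R)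
    (h0 : (R 0).Nonempty)
    (hgrow : ∀ t, R t ≠ Finset.univ → (R t).card < (R (t + q)).card) :
    R (Fintype.card ι * q) = Finset.univ := by
  have hcard : ∀ s, R (s * q) = Finset.univ ∨ s < (R (s * q)).card := by
    intro s
    induction s with
    | zero => exact Or.inr (by simpa using h0)
    | succ s ih =>
      rw [Nat.succ_mul]
      by_cases h : R (s * q) = Finset.univ
      · exact Or.inl (Finset.univ_subset_iff.1 (h ▸ hR (Nat.le_add_right _ _)))
      · have := hgrow _ h
        have := ih.resolve_left h
        exact Or.inr (by omega)
  exact (hcard _).resolve_right (Finset.card_le_univ _).not_gt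

theorem sum_smul_sum_smul {ι V : Type*} [Fintype ι] [AddCommGroup V] [Module ℝ V]
    (A B : Matrix ι ι ℝ) (f : ι → V) (i : ι) :
    ∑ l, A i l • ∑ p, B l p • f p = ∑ p, (A * B) i p • f p := by
  simp only [Matrix.mul_apply, Finset.smul_sum, Finset.sum_smul, smul_smul]
  exact Finset.sum_comm

/-- The transition matrix `W (j + t - 1) * ⋯ * W j` of the system `v (k + 1) = W k v k`, from time
`j` to time `j + t`. -/
def transition {ι : Type*} [Fintype ι] [DecidableEq ι] (W : ℕ → Matrix ι ι ℝ) (j : ℕ) :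
    ℕ → Matrix ι ι ℝ
  | 0 => 1
  | t + 1 => W (j + t) * transition W j t

/-- The entries of `l` at time `j` carry weight at least `ε ^ t` in the states of these indices at
time `j + t`. -/
noncomputable def reach {ι : Type*} [Fintype ι] [DecidableEq ι] (W : ℕ → Matrix ι ι ℝ) (ε : ℝ)
    (j : ℕ) (l : ι) (t : ℕ) : Finset ι :=
  {p | ε ^ t ≤ transition W j t p l}

/-- Doubly stochastic matrices whose products converge to averaging, at the geometric rate `ρ`
uniformly in the starting time. -/
structure MixesGeometrically {ι : Type*} [Fintype ι] [DecidableEq ι] (W : ℕ → Matrix ι ι ℝ)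
    (C ρ : ℝ) : Prop where
  mem_doublyStochastic : ∀ k, W k ∈ doublyStochastic ℝ ι
  C_pos : 0 < C
  ρ_pos : 0 < ρ
  ρ_lt_one : ρ < 1
  abs_transition_sub_le :
    ∀ j t i l, |transition W j t i l - 1 / (Fintype.card ι : ℝ)| ≤ C * ρ ^ t

section Transition

variable {ι : Type*} [Fintype ι] [DecidableEq ι] {W : ℕ → Matrix ι ι ℝ}

theorem transition_add (W : ℕ → Matrix ι ι ℝ) (j s t : ℕ) :
    transition W j (s + t) = transition W (j + s) t * transition W j s := by
  induction t with
  | zero => simp [transition]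
  | succ t ih => rw [← add_assoc, transition, transition, ih, Matrix.mul_assoc, add_assoc]

theorem transition_nonneg (hW : ∀ k i l, 0 ≤ W k i l) (j t : ℕ) (i l : ι) :
    0 ≤ transition W j t i l := by
  induction t generalizing i with
  | zero => rw [transition, Matrix.one_apply]; split_ifs <;> norm_num
  | succ t ih =>
    rw [transition, Matrix.mul_apply]
    exact Finset.sum_nonneg fun p _ => mul_nonneg (hW _ _ _) (ih p)

theorem transition_mem_doublyStochastic (hW : ∀ k, W k ∈ doublyStochastic ℝ ι) (j t : ℕ) :
    transition W j t ∈ doublyStochastic ℝ ι := by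
  induction t with
  | zero => exact one_mem _
  | succ t ih => exact mul_mem (hW _) ih

theorem pow_le_transition_succ {ε : ℝ} (hε : 0 ≤ ε) (hW : ∀ k i l, 0 ≤ W k i l) {j t : ℕ}
    {p q l : ι} (hqp : ε ≤ W (j + t) q p) (hp : ε ^ t ≤ transition W j t p l) :
    ε ^ (t + 1) ≤ transition W j (t + 1) q l := by
  rw [transition, Matrix.mul_apply, pow_succ']
  calc ε * ε ^ t ≤ W (j + t) q p * transition W j t p l :=
        mul_le_mul hqp hp (pow_nonneg hε t) (hW _ _ _)
    _ ≤ ∑ p, W (j + t) q p * transition W j t p l := Finset.single_le_sum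
        (f := fun p => W (j + t) q p * transition W j t p l)
        (fun p _ => mul_nonneg (hW _ _ _) (transition_nonneg hW _ _ _ _)) (Finset.mem_univ p)

theorem mem_reach {ε : ℝ} {j t : ℕ} {l p : ι} :
    p ∈ reach W ε j l t ↔ ε ^ t ≤ transition W j t p l := by
  simp [reach]

theorem mem_reach_zero (W : ℕ → Matrix ι ι ℝ) (ε : ℝ) (j : ℕ) (l : ι) : l ∈ reach W ε j l 0 := by
  simp [mem_reach, transition]

section Connected

variable {ε : ℝ} {G : ℕ → SimpleGraph ι}

theorem reach_mono (hε : 0 ≤ ε) (hW : ∀ k i l, 0 ≤ W k i l) (hdiag : ∀ k i, ε ≤ W k i i)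
    (j : ℕ) (l : ι) : Monotone (reach W ε j l) :=
  monotone_nat_of_le_succ fun _ _ hp =>
    mem_reach.2 (pow_le_transition_succ hε hW (hdiag _ _) (mem_reach.1 hp))

theorem card_reach_lt (hε : 0 ≤ ε) (hW : ∀ k i l, 0 ≤ W k i l) (hdiag : ∀ k i, ε ≤ W k i i)
    (hadj : ∀ k i l, (G k).Adj i l → ε ≤ W k i l) {Q : ℕ}
    (hG : ∀ k, (⨆ ℓ ∈ Finset.Icc 1 Q, G (ℓ + k)).Connected) {j t : ℕ} {l : ι}
    (ht : reach W ε j l t ≠ Finset.univ) :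
    (reach W ε j l t).card < (reach W ε j l (t + (Q + 1))).card := by
  have hmono := reach_mono hε hW hdiag j l
  obtain ⟨q, hq⟩ : ∃ q, q ∉ reach W ε j l t := by
    simpa [Finset.eq_univ_iff_forall] using ht
  obtain ⟨walk⟩ := (hG (j + t)).preconnected l q
  obtain ⟨d, -, hfst, hsnd⟩ := walk.exists_boundary_dart (reach W ε j l t : Set ι)
    (by exact_mod_cast hmono (Nat.zero_le t) (mem_reach_zero W ε j l)) (by exact_mod_cast hq)
  obtain ⟨s, hs, hd⟩ : ∃ s, s ∈ Finset.Icc 1 Q ∧ (G (s + (j + t))).Adj d.fst d.snd := by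
    simpa [SimpleGraph.iSup_adj] using d.adj
  rw [Finset.mem_Icc] at hs
  have hfst' : d.fst ∈ reach W ε j l (s + t) :=
    hmono (Nat.le_add_left t s) (by exact_mod_cast hfst)
  have hsnd' : d.snd ∈ reach W ε j l (s + t + 1) := by
    refine mem_reach.2 (pow_le_transition_succ hε hW (hadj _ _ _ ?_) (mem_reach.1 hfst'))
    rw [Nat.add_left_comm]
    exact hd.symm
  exact Finset.card_lt_card ((Finset.ssubset_iff_of_subset (hmono (by omega))).2
    ⟨d.snd, hmono (by omega) hsnd', by exact_mod_cast hsnd⟩)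

theorem exists_pow_le_transition (hε : 0 ≤ ε) (hW : ∀ k i l, 0 ≤ W k i l)
    (hdiag : ∀ k i, ε ≤ W k i i) (hadj : ∀ k i l, (G k).Adj i l → ε ≤ W k i l) {Q : ℕ}
    (hG : ∀ k, (⨆ ℓ ∈ Finset.Icc 1 Q, G (ℓ + k)).Connected) :
    ∃ T, 0 < T ∧ ∀ j i l, ε ^ T ≤ transition W j T i l := by
  have := (hG 0).nonempty
  refine ⟨Fintype.card ι * (Q + 1), by positivity, fun j i l => mem_reach.1 ?_⟩
  rw [eq_univ_of_card_lt_card (reach_mono hε hW hdiag j l) ⟨l, mem_reach_zero W ε j l⟩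
    fun t => card_reach_lt hε hW hdiag hadj hG]
  exact Finset.mem_univ i

end Connected

theorem abs_sub_inv_card_le_one {A : Matrix ι ι ℝ} (hA : A ∈ doublyStochastic ℝ ι) (i l : ι) :
    |A i l - 1 / (Fintype.card ι : ℝ)| ≤ 1 := by
  have hA0 := nonneg_of_mem_doublyStochastic hA (i := i) (j := l)
  have hA1 := le_one_of_mem_doublyStochastic hA (i := i) (j := l)
  have : Nonempty ι := ⟨i⟩
  have hcard : (1 : ℝ) ≤ Fintype.card ι := by exact_mod_cast Fintype.card_pos
  have hinv : 1 / (Fintype.card ι : ℝ) ≤ 1 := (div_le_one (by positivity)).2 hcard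
  have hpos : 0 ≤ 1 / (Fintype.card ι : ℝ) := by positivity
  rw [abs_le]
  constructor <;> linarith

/- Subtracting `κ` from the entries of `A` does not change the left-hand side, because the columns
of `B - 1 / card ι` sum to `0`; it leaves nonnegative weights of total mass `1 - card ι * κ`. -/
theorem abs_mul_sub_inv_card_le {A B : Matrix ι ι ℝ} {κ c : ℝ} (hA : A ∈ doublyStochastic ℝ ι)
    (hκ : ∀ i p, κ ≤ A i p) (hB : B ∈ doublyStochastic ℝ ι)
    (hc : ∀ i l, |B i l - 1 / (Fintype.card ι : ℝ)| ≤ c) (i l : ι) :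
    |(A * B) i l - 1 / (Fintype.card ι : ℝ)| ≤ (1 - Fintype.card ι * κ) * c := by
  have hrow : ∑ p, A i p = 1 := sum_row_of_mem_doublyStochastic hA i
  have hcol : ∑ p, B p l = 1 := sum_col_of_mem_doublyStochastic hB l
  have : Nonempty ι := ⟨i⟩
  have hshift : (A * B) i l - 1 / (Fintype.card ι : ℝ)
      = ∑ p, (A i p - κ) * (B p l - 1 / (Fintype.card ι : ℝ)) := by
    simp only [Matrix.mul_apply, sub_mul, mul_sub, Finset.sum_sub_distrib, ← Finset.sum_mul,
      ← Finset.mul_sum, hrow, hcol, Finset.sum_const, Finset.card_univ, nsmul_eq_mul]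
    field_simp
    ring
  rw [hshift]
  calc |∑ p, (A i p - κ) * (B p l - 1 / (Fintype.card ι : ℝ))|
      ≤ ∑ p, (A i p - κ) * c := by
        refine (Finset.abs_sum_le_sum_abs _ _).trans (Finset.sum_le_sum fun p _ => ?_)
        rw [abs_mul, abs_of_nonneg (sub_nonneg.2 (hκ i p))]
        exact mul_le_mul_of_nonneg_left (hc p l) (sub_nonneg.2 (hκ i p))
    _ = (1 - Fintype.card ι * κ) * c := by
        rw [← Finset.sum_mul, Finset.sum_sub_distrib, hrow]
        simp

theorem abs_transition_sub_le_pow (hW : ∀ k, W k ∈ doublyStochastic ℝ ι) {T : ℕ} {κ : ℝ}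
    (hT : ∀ j i l, κ ≤ transition W j T i l) (j r s : ℕ) (i l : ι) :
    |transition W j (r + s * T) i l - 1 / (Fintype.card ι : ℝ)|
      ≤ (1 - Fintype.card ι * κ) ^ s := by
  have hmem := transition_mem_doublyStochastic hW
  induction s generalizing i l with
  | zero => simpa using abs_sub_inv_card_le_one (hmem j (r + 0 * T)) i l
  | succ s ih =>
    rw [Nat.succ_mul, ← add_assoc, transition_add, pow_succ']
    exact abs_mul_sub_inv_card_le (hmem _ _) (hT _) (hmem _ _) ih i l

theorem exists_pow_div_le_mul_pow {θ : ℝ} (hθ : 0 ≤ θ) (hθ1 : θ < 1) {T : ℕ} (hT : 0 < T) :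
    ∃ C ρ : ℝ, 0 < C ∧ 0 < ρ ∧ ρ < 1 ∧ ∀ t : ℕ, θ ^ (t / T) ≤ C * ρ ^ t := by
  set η := max θ (1 / 2)
  have hη : 0 < η := lt_max_of_lt_right (by norm_num)
  have hη1 : η < 1 := max_lt hθ1 (by norm_num)
  set ρ := η ^ (T : ℝ)⁻¹
  have hρ : 0 < ρ := Real.rpow_pos_of_pos hη _
  have hρ1 : ρ < 1 := Real.rpow_lt_one hη.le hη1 (by positivity)
  have hρT : ρ ^ T = η := Real.rpow_inv_natCast_pow hη.le hT.ne'
  refine ⟨(ρ ^ T)⁻¹, ρ, by positivity, hρ, hρ1, fun t => ?_⟩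
  calc θ ^ (t / T) ≤ (ρ ^ T) ^ (t / T) := by
        rw [hρT]
        gcongr
        exact le_max_left _ _
    _ = ρ ^ (T * (t / T)) := (pow_mul _ _ _).symm
    _ ≤ (ρ ^ T)⁻¹ * ρ ^ t := by
        rw [inv_mul_eq_div, le_div_iff₀ (by positivity), ← pow_add]
        refine pow_le_pow_of_le_one hρ.le hρ1.le ?_
        have := Nat.div_add_mod t T
        have := Nat.mod_lt t hT
        omega

theorem exists_mixesGeometrically [Nonempty ι] (hW : ∀ k, W k ∈ doublyStochastic ℝ ι) {T : ℕ}
    (hT0 : 0 < T) {κ : ℝ} (hκ : 0 < κ) (hT : ∀ j i l, κ ≤ transition W j T i l) :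
    ∃ C ρ, MixesGeometrically W C ρ := by
  have hθ : 0 ≤ 1 - Fintype.card ι * κ := by
    obtain ⟨i⟩ := ‹Nonempty ι›
    rw [sub_nonneg,
      ← sum_row_of_mem_doublyStochastic (transition_mem_doublyStochastic hW 0 T) i]
    simpa using Finset.card_nsmul_le_sum Finset.univ _ κ fun l _ => hT 0 i l
  have hθ1 : 1 - Fintype.card ι * κ < 1 := by
    have : 0 < Fintype.card ι * κ := by positivity
    linarith
  obtain ⟨C, ρ, hC, hρ, hρ1, h⟩ := exists_pow_div_le_mul_pow hθ hθ1 hT0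
  refine ⟨C, ρ, hW, hC, hρ, hρ1, fun j t i l => ?_⟩
  rw [← Nat.mod_add_div' t T]
  refine (abs_transition_sub_le_pow hW hT j (t % T) (t / T) i l).trans ?_
  rw [Nat.mod_add_div' t T]
  exact h t

theorem MixesGeometrically.nonneg {C ρ : ℝ} (hW : MixesGeometrically W C ρ) (k : ℕ) (i l : ι) :
    0 ≤ W k i l :=
  nonneg_of_mem_doublyStochastic (hW.mem_doublyStochastic k)

section Solution

variable {V : Type*}

theorem solution_eq_transition [AddCommGroup V] [Module ℝ V] {j : ℕ} {v u : ℕ → ι → V}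
    (hv : ∀ t i, v (t + 1) i = ∑ l, W (j + t) i l • v t l + u t i) (t : ℕ) (i : ι) :
    v t i = ∑ l, transition W j t i l • v 0 l
      + ∑ r ∈ Finset.range t, ∑ l, transition W (j + r + 1) (t - 1 - r) i l • u r l := by
  induction t generalizing i with
  | zero => simp [transition, Matrix.one_apply]
  | succ t ih =>
    rw [hv, Finset.sum_range_succ]
    simp only [ih, smul_add, Finset.sum_add_distrib]
    rw [sum_smul_sum_smul, transition, add_assoc]
    congr 2
    · simp only [Finset.smul_sum (s := Finset.range t)]
      rw [Finset.sum_comm]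
      refine Finset.sum_congr rfl fun r hr => ?_
      rw [Finset.mem_range] at hr
      rw [sum_smul_sum_smul, show t + 1 - 1 - r = (t - 1 - r) + 1 by omega, transition,
        show j + r + 1 + (t - 1 - r) = j + t by omega]
    · simp [transition, Matrix.one_apply]

theorem sum_solution_eq [AddCommGroup V] [Module ℝ V] (hW : ∀ k, W k ∈ doublyStochastic ℝ ι)
    {j : ℕ} {v u : ℕ → ι → V}
    (hv : ∀ t i, v (t + 1) i = ∑ l, W (j + t) i l • v t l + u t i) (t : ℕ) :
    ∑ l, v t l = ∑ l, v 0 l + ∑ r ∈ Finset.range t, ∑ l, u r l := by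
  induction t with
  | zero => simp
  | succ t ih =>
    rw [Finset.sum_range_succ, ← add_assoc, ← ih]
    simp only [hv, Finset.sum_add_distrib]
    rw [Finset.sum_comm]
    simp only [← Finset.sum_smul, sum_col_of_mem_doublyStochastic (hW _), one_smul]

theorem norm_sub_mean_le {C ρ : ℝ} (hW : MixesGeometrically W C ρ) [NormedAddCommGroup V]
    [NormedSpace ℝ V] {j : ℕ} {v u : ℕ → ι → V}
    (hv : ∀ t i, v (t + 1) i = ∑ l, W (j + t) i l • v t l + u t i) (t : ℕ) (i : ι) :
    ‖v t i - (1 / (Fintype.card ι : ℝ)) • ∑ l, v t l‖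
      ≤ C * (ρ ^ t * ∑ l, ‖v 0 l‖ + geomConv ρ (fun r => ∑ l, ‖u r l‖) t) := by
  have hsplit : v t i - (1 / (Fintype.card ι : ℝ)) • ∑ l, v t l
      = ∑ l, (transition W j t i l - 1 / (Fintype.card ι : ℝ)) • v 0 l + ∑ r ∈ Finset.range t,
        ∑ l, (transition W (j + r + 1) (t - 1 - r) i l - 1 / (Fintype.card ι : ℝ)) • u r l := by
    rw [sum_solution_eq hW.mem_doublyStochastic hv, solution_eq_transition hv]
    simp only [sub_smul, Finset.sum_sub_distrib, smul_add, Finset.smul_sum]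
    abel
  have hdecay : ∀ (j t : ℕ) (f : ι → V),
      ‖∑ l, (transition W j t i l - 1 / (Fintype.card ι : ℝ)) • f l‖
        ≤ C * ρ ^ t * ∑ l, ‖f l‖ := by
    intro j t f
    rw [Finset.mul_sum]
    refine norm_sum_le_of_le _ fun l _ => ?_
    rw [norm_smul, Real.norm_eq_abs]
    exact mul_le_mul_of_nonneg_right (hW.abs_transition_sub_le _ _ _ _) (norm_nonneg _)
  rw [hsplit, mul_add, ← mul_assoc, geomConv, Finset.mul_sum (Finset.range t)]
  exact norm_add_le_of_le (hdecay _ _ _)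
    (norm_sum_le_of_le _ fun r _ => (hdecay _ _ _).trans_eq (mul_assoc _ _ _))

end Solution

end Transition

/-- The fraction of an initial value that survives the relaxation steps `j, …, j + t - 1`. -/
def retain (γ : ℕ → ℝ) (j t : ℕ) : ℝ := ∏ r ∈ Finset.range t, (1 - γ (j + r))

/-- The response of the tracking variables at time `j + t` to unit values entering at time `j` and
fading out by relaxation. -/
def response {ι : Type*} [Fintype ι] [DecidableEq ι] (W : ℕ → Matrix ι ι ℝ) (γ : ℕ → ℝ) (j : ℕ) :
    ℕ → Matrix ι ι ℝ
  | 0 => 1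
  | t + 1 => W (j + t) * response W γ j t - (γ (j + t) * retain γ j t) • 1

section Retain

variable {γ : ℕ → ℝ}

theorem retain_zero (γ : ℕ → ℝ) (j : ℕ) : retain γ j 0 = 1 := by simp [retain]

theorem retain_succ (γ : ℕ → ℝ) (j t : ℕ) :
    retain γ j (t + 1) = retain γ j t * (1 - γ (j + t)) := by
  rw [retain, Finset.prod_range_succ, retain]

theorem retain_add (γ : ℕ → ℝ) (j s t : ℕ) :
    retain γ j (s + t) = retain γ j s * retain γ (j + s) t := by
  simp only [retain, Finset.prod_range_add, add_assoc]

theorem retain_nonneg (h1 : ∀ k, γ k ≤ 1) (j t : ℕ) : 0 ≤ retain γ j t :=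
  Finset.prod_nonneg fun _ _ => sub_nonneg.2 (h1 _)

theorem retain_le_one (h0 : ∀ k, 0 ≤ γ k) (h1 : ∀ k, γ k ≤ 1) (j t : ℕ) : retain γ j t ≤ 1 :=
  Finset.prod_le_one (fun _ _ => sub_nonneg.2 (h1 _)) fun r _ => by linarith [h0 (j + r)]

/- Only the steps before `K`, where `1 - γ` may lie below `q`, are charged to `1 - γ 0`. -/
theorem pow_min_mul_pow_le_retain (hanti : Antitone γ) (hγ0 : 0 ≤ γ 0) (hγ1 : γ 0 < 1) {q : ℝ}
    (hq0 : 0 < q) (hq1 : q < 1) {K : ℕ} (hK : ∀ k, K ≤ k → q ≤ 1 - γ k) (j t : ℕ) :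
    (1 - γ 0) ^ min t K * q ^ t ≤ retain γ j t := by
  have hp : 0 < 1 - γ 0 := sub_pos.2 hγ1
  induction t with
  | zero => simp [retain_zero]
  | succ t ih =>
    rw [retain_succ]
    have hnn : 0 ≤ (1 - γ 0) ^ min t K * q ^ t := by positivity
    by_cases h : K ≤ j + t
    · calc (1 - γ 0) ^ min (t + 1) K * q ^ (t + 1)
          ≤ (1 - γ 0) ^ min t K * q ^ t * q := by
            rw [pow_succ, ← mul_assoc]
            gcongr ?_ * _ * _
            exact pow_le_pow_of_le_one hp.le (by linarith) (by omega)
        _ ≤ retain γ j t * (1 - γ (j + t)) := mul_le_mul ih (hK _ h) hq0.le (hnn.trans ih)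
    · have hγj : 1 - γ 0 ≤ 1 - γ (j + t) := by linarith [hanti (Nat.zero_le (j + t))]
      rw [show min (t + 1) K = min t K + 1 by omega]
      calc (1 - γ 0) ^ (min t K + 1) * q ^ (t + 1)
          = ((1 - γ 0) ^ min t K * q ^ t) * (1 - γ 0) * q := by ring
        _ ≤ ((1 - γ 0) ^ min t K * q ^ t) * (1 - γ 0) :=
            mul_le_of_le_one_right (by positivity) hq1.le
        _ ≤ retain γ j t * (1 - γ (j + t)) := mul_le_mul ih hγj hp.le (hnn.trans ih)

theorem exists_mul_pow_le_retain (hanti : Antitone γ) (hγ0 : 0 ≤ γ 0) (hγ1 : γ 0 < 1)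
    (hlim : Tendsto γ atTop (𝓝 0)) {q : ℝ} (hq0 : 0 < q) (hq1 : q < 1) :
    ∃ c, 0 < c ∧ ∀ j t, c * q ^ t ≤ retain γ j t := by
  obtain ⟨K, hK⟩ := eventually_atTop.1 (hlim.eventually_le_const (sub_pos.2 hq1))
  have hp : 0 < 1 - γ 0 := sub_pos.2 hγ1
  refine ⟨(1 - γ 0) ^ K, by positivity, fun j t => le_trans ?_
    (pow_min_mul_pow_le_retain hanti hγ0 hγ1 hq0 hq1 (fun k hk => by linarith [hK k hk]) j t)⟩
  gcongr ?_ * _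
  exact pow_le_pow_of_le_one hp.le (by linarith) (min_le_right _ _)

theorem pow_le_retain_mul {ρ c q : ℝ} (hρ : 0 ≤ ρ) (hc : 0 < c) (hq : 0 < q)
    (hret : ∀ j t, c * q ^ t ≤ retain γ j t) (j t : ℕ) :
    ρ ^ t ≤ retain γ j t * ((ρ / q) ^ t / c) := by
  calc ρ ^ t = c * q ^ t * ((ρ / q) ^ t / c) := by
        rw [div_pow]
        field_simp
    _ ≤ retain γ j t * ((ρ / q) ^ t / c) := mul_le_mul_of_nonneg_right (hret j t) (by positivity)

theorem geomConv_retain_le {ρ c q : ℝ} (hρ : 0 ≤ ρ) (hc : 0 < c) (hq : 0 < q)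
    (h0 : ∀ k, 0 ≤ γ k) (h1 : ∀ k, γ k ≤ 1) (hret : ∀ j t, c * q ^ t ≤ retain γ j t) (j t : ℕ) :
    geomConv ρ (fun r => γ (j + r) * retain γ j r) t
      ≤ retain γ j t * (geomConv (ρ / q) γ (j + t) / (c * q)) := by
  have hshift := geomConv_shift_le (div_nonneg hρ hq.le) h0 j t
  refine le_trans ?_ (mul_le_mul_of_nonneg_left (div_le_div_of_nonneg_right hshift (by positivity))
    (retain_nonneg h1 j t))
  rw [geomConv, geomConv, Finset.sum_div, Finset.mul_sum]
  refine Finset.sum_le_sum fun r hr => ?_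
  obtain ⟨s, rfl⟩ : ∃ s, t = r + (s + 1) :=
    ⟨t - 1 - r, by have := Finset.mem_range.1 hr; omega⟩
  have hnn : 0 ≤ (ρ / q) ^ s * (γ (j + r) * retain γ j r) / (c * q) :=
    div_nonneg (mul_nonneg (by positivity) (mul_nonneg (h0 _) (retain_nonneg h1 _ _)))
      (by positivity)
  rw [retain_add, show r + (s + 1) - 1 - r = s by omega]
  calc ρ ^ s * (γ (j + r) * retain γ j r)
      = (ρ / q) ^ s * (γ (j + r) * retain γ j r) / (c * q) * (c * q ^ (s + 1)) := by
        rw [div_pow, pow_succ]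
        field_simp
    _ ≤ (ρ / q) ^ s * (γ (j + r) * retain γ j r) / (c * q) * retain γ (j + r) (s + 1) :=
        mul_le_mul_of_nonneg_left (hret _ _) hnn
    _ = retain γ j r * retain γ (j + r) (s + 1) * ((ρ / q) ^ s * γ (j + r) / (c * q)) := by ring

theorem relaxation_eq_retain {V : Type*} [AddCommGroup V] [Module ℝ V] {a b : ℕ → V}
    (ha : ∀ k, a (k + 1) = a k + γ k • (b k - a k)) (k : ℕ) :
    a k = retain γ 0 k • a 0
      + ∑ r ∈ Finset.range k, (γ r * retain γ (r + 1) (k - 1 - r)) • b r := by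
  induction k with
  | zero => simp [retain_zero]
  | succ k ih =>
    have hstep : ∀ r ∈ Finset.range k, (γ r * retain γ (r + 1) (k + 1 - 1 - r)) • b r
        = (1 - γ k) • ((γ r * retain γ (r + 1) (k - 1 - r)) • b r) := by
      intro r hr
      rw [Finset.mem_range] at hr
      rw [show k + 1 - 1 - r = (k - 1 - r) + 1 by omega, retain_succ,
        show r + 1 + (k - 1 - r) = k by omega, smul_smul]
      ring_nf
    rw [Finset.sum_range_succ, Finset.sum_congr rfl hstep, ← Finset.smul_sum, retain_succ, ha,
      show k + 1 - 1 - k = 0 by omega, retain_zero, zero_add, mul_one]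
    nth_rw 1 2 [ih]
    module

end Retain

section Response

variable {ι : Type*} [Fintype ι] [DecidableEq ι] {W : ℕ → Matrix ι ι ℝ} {γ : ℕ → ℝ}

theorem response_succ_apply (W : ℕ → Matrix ι ι ℝ) (γ : ℕ → ℝ) (j t : ℕ) (i l : ι) :
    response W γ j (t + 1) i l = ∑ p, W (j + t) i p * response W γ j t p l
      - γ (j + t) * retain γ j t * (1 : Matrix ι ι ℝ) i l := by
  simp [response, Matrix.mul_apply]

theorem sum_response_col (hW : ∀ k, W k ∈ doublyStochastic ℝ ι) (j t : ℕ) (l : ι) :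
    ∑ i, response W γ j t i l = retain γ j t := by
  induction t with
  | zero => simp [response, Matrix.one_apply, retain_zero]
  | succ t ih =>
    simp only [response_succ_apply, Finset.sum_sub_distrib]
    rw [Finset.sum_comm, retain_succ]
    simp only [← Finset.sum_mul, sum_col_of_mem_doublyStochastic (hW _), one_mul, ih,
      ← Finset.mul_sum, Matrix.one_apply, Finset.sum_ite_eq', Finset.mem_univ, if_true]
    ring

theorem abs_response_sub_le {C ρ : ℝ} (hW : MixesGeometrically W C ρ) (h0 : ∀ k, 0 ≤ γ k)
    (h1 : ∀ k, γ k ≤ 1) (j t : ℕ) (i l : ι) :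
    |response W γ j t i l - retain γ j t / Fintype.card ι|
      ≤ C * (ρ ^ t + geomConv ρ (fun r => γ (j + r) * retain γ j r) t) := by
  have h := norm_sub_mean_le hW (j := j) (v := fun t i => response W γ j t i l)
    (u := fun t i => -(γ (j + t) * retain γ j t * (1 : Matrix ι ι ℝ) i l))
    (fun t i => by simp [response_succ_apply, sub_eq_add_neg]) t i
  have hu : ∀ r, ∑ i, ‖-(γ (j + r) * retain γ j r * (1 : Matrix ι ι ℝ) i l)‖
      = γ (j + r) * retain γ j r := by
    intro r
    have hnn := mul_nonneg (h0 (j + r)) (retain_nonneg h1 j r)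
    simp only [norm_neg, norm_mul (γ (j + r) * retain γ j r), ← Finset.mul_sum,
      Real.norm_of_nonneg hnn]
    simp [Matrix.one_apply, apply_ite]
  have hv : ∑ i, ‖response W γ j 0 i l‖ = 1 := by
    simp [response, Matrix.one_apply, apply_ite]
  simp only [hu, hv, sum_response_col hW.mem_doublyStochastic, smul_eq_mul, mul_one] at h
  rwa [one_div, inv_mul_eq_div, Real.norm_eq_abs] at h

theorem retain_mul_le_response {C ρ c q : ℝ} (hW : MixesGeometrically W C ρ)
    (h0 : ∀ k, 0 ≤ γ k) (h1 : ∀ k, γ k ≤ 1) (hc : 0 < c) (hq : 0 < q)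
    (hret : ∀ j t, c * q ^ t ≤ retain γ j t) (j t : ℕ) (i l : ι) :
    retain γ j t * (1 / Fintype.card ι
        - C / c * ((ρ / q) ^ t + geomConv (ρ / q) γ (j + t) / q))
      ≤ response W γ j t i l := by
  have hresp := (abs_le.1 (abs_response_sub_le hW h0 h1 j t i l)).1
  have herr := mul_le_mul_of_nonneg_left (add_le_add (pow_le_retain_mul hW.ρ_pos.le hc hq hret j t)
    (geomConv_retain_le hW.ρ_pos.le hc hq h0 h1 hret j t)) hW.C_pos.le
  calc retain γ j t * (1 / Fintype.card ι
        - C / c * ((ρ / q) ^ t + geomConv (ρ / q) γ (j + t) / q))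
      = retain γ j t / Fintype.card ι - C * (retain γ j t * ((ρ / q) ^ t / c)
          + retain γ j t * (geomConv (ρ / q) γ (j + t) / (c * q))) := by field_simp
    _ ≤ response W γ j t i l := by linarith

section SmallSteps

variable {ε : ℝ}

theorem pow_sub_le_response_succ (hε : 0 ≤ ε) (hε1 : ε ≤ 1) (hW : ∀ k i l, 0 ≤ W k i l)
    (hdiag : ∀ k i, ε ≤ W k i i) (hanti : Antitone γ) (h0 : ∀ k, 0 ≤ γ k) (h1 : ∀ k, γ k ≤ 1)
    {j t : ℕ} {l : ι} (hnn : ∀ i, 0 ≤ response W γ j t i l)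
    (ht : ε ^ t - t * γ j ≤ response W γ j t l l) :
    ε ^ (t + 1) - (t + 1 : ℕ) * γ j ≤ response W γ j (t + 1) l l := by
  rw [response_succ_apply, Matrix.one_apply_eq, mul_one]
  have hterm : W (j + t) l l * response W γ j t l l
      ≤ ∑ p, W (j + t) l p * response W γ j t p l :=
    Finset.single_le_sum (f := fun p => W (j + t) l p * response W γ j t p l)
      (fun p _ => mul_nonneg (hW _ _ _) (hnn p)) (Finset.mem_univ l)
  have hself : ε * response W γ j t l l ≤ W (j + t) l l * response W γ j t l l :=
    mul_le_mul_of_nonneg_right (hdiag _ _) (hnn l)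
  have hloss : γ (j + t) * retain γ j t ≤ γ j :=
    (mul_le_of_le_one_right (h0 _) (retain_le_one h0 h1 j t)).trans (hanti (Nat.le_add_right j t))
  have hscale : ε * (t * γ j) ≤ t * γ j :=
    mul_le_of_le_one_left (mul_nonneg (Nat.cast_nonneg _) (h0 j)) hε1
  have := mul_le_mul_of_nonneg_left ht hε
  rw [pow_succ']
  push_cast
  linarith

theorem response_nonneg_of_mul_le_pow (hε : 0 ≤ ε) (hε1 : ε ≤ 1) (hW : ∀ k i l, 0 ≤ W k i l)
    (hdiag : ∀ k i, ε ≤ W k i i) (hanti : Antitone γ) (h0 : ∀ k, 0 ≤ γ k) (h1 : ∀ k, γ k ≤ 1)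
    {j T : ℕ} (hj : T * γ j ≤ ε ^ T) {t : ℕ} (ht : t ≤ T) (l : ι) :
    (∀ i, 0 ≤ response W γ j t i l) ∧ ε ^ t - t * γ j ≤ response W γ j t l l := by
  induction t with
  | zero =>
    refine ⟨fun i => ?_, by simp [response]⟩
    rw [response, Matrix.one_apply]
    split_ifs <;> norm_num
  | succ t ih =>
    obtain ⟨hnn, hdiag_t⟩ := ih (by omega)
    have hdiag_succ := pow_sub_le_response_succ hε hε1 hW hdiag hanti h0 h1 hnn hdiag_t
    refine ⟨fun i => ?_, hdiag_succ⟩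
    rcases eq_or_ne i l with rfl | hil
    · have hpow : ε ^ T ≤ ε ^ (t + 1) := pow_le_pow_of_le_one hε hε1 ht
      have hmul : (t + 1 : ℕ) * γ j ≤ T * γ j :=
        mul_le_mul_of_nonneg_right (by exact_mod_cast ht) (h0 j)
      linarith
    · rw [response_succ_apply, Matrix.one_apply_ne hil, mul_zero, sub_zero]
      exact Finset.sum_nonneg fun p _ => mul_nonneg (hW _ _ _) (hnn p)

end SmallSteps

/- For large `t` mixing dominates: `retain` decays slower than `ρ ^ t`, so the response is close to
the positive matrix `retain γ j t / card ι`. For bounded `t`, and hence large `j`, the diagonal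
entries outweigh the small relaxations. -/
theorem exists_response_nonneg {C ρ ε : ℝ} (hW : MixesGeometrically W C ρ) (hε : 0 < ε)
    (hdiag : ∀ k i, ε ≤ W k i i) (hanti : Antitone γ) (h0 : ∀ k, 0 ≤ γ k) (hγ1 : γ 0 < 1)
    (hlim : Tendsto γ atTop (𝓝 0)) :
    ∃ K, ∀ j t, K ≤ j + t → ∀ i l, 0 ≤ response W γ j t i l := by
  cases isEmpty_or_nonempty ι
  · exact ⟨0, fun _ _ _ i => isEmptyElim i⟩
  have h1 : ∀ k, γ k ≤ 1 := fun k => (hanti k.zero_le).trans hγ1.le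
  have hε1 : ε ≤ 1 := (hdiag 0 (Classical.arbitrary ι)).trans
    (le_one_of_mem_doublyStochastic (hW.mem_doublyStochastic 0))
  obtain ⟨q, hρq, hq1⟩ := exists_between hW.ρ_lt_one
  have hq0 : 0 < q := hW.ρ_pos.trans hρq
  obtain ⟨c, hc, hret⟩ := exists_mul_pow_le_retain hanti (h0 0) hγ1 hlim hq0 hq1
  have hrate0 : 0 ≤ ρ / q := div_nonneg hW.ρ_pos.le hq0.le
  have hrate1 : ρ / q < 1 := (div_lt_one hq0).2 hρq
  have hhalf : 0 < 1 / (2 * (Fintype.card ι : ℝ)) := by positivity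
  have hpow : Tendsto (fun t => C / c * (ρ / q) ^ t) atTop (𝓝 0) := by
    simpa using (tendsto_pow_atTop_nhds_zero_of_lt_one hrate0 hrate1).const_mul (C / c)
  have hconv : Tendsto (fun k => C / c * (geomConv (ρ / q) γ k / q)) atTop (𝓝 0) := by
    simpa using ((tendsto_geomConv hrate0 hrate1 h0 hlim).div_const q).const_mul (C / c)
  obtain ⟨T, hT⟩ := eventually_atTop.1 (hpow.eventually_lt_const hhalf)
  obtain ⟨K, hK⟩ := eventually_atTop.1 (hconv.eventually_lt_const hhalf)
  have hsmall : Tendsto (fun k => (T : ℝ) * γ k) atTop (𝓝 0) := by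
    simpa using hlim.const_mul (T : ℝ)
  obtain ⟨J, hJ⟩ := eventually_atTop.1 (hsmall.eventually_le_const (pow_pos hε T))
  refine ⟨max K (J + T), fun j t hjt i l => ?_⟩
  rcases le_total T t with htT | htT
  · refine le_trans (mul_nonneg (retain_nonneg h1 _ _) ?_)
      (retain_mul_le_response hW h0 h1 hc hq0 hret j t i l)
    have hsplit : 1 / (Fintype.card ι : ℝ)
        = 1 / (2 * (Fintype.card ι : ℝ)) + 1 / (2 * (Fintype.card ι : ℝ)) := by
      field_simp
      norm_num
    rw [mul_add]
    linarith [hT t htT, hK (j + t) ((le_max_left _ _).trans hjt)]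
  · have hj : J ≤ j := by
      have := (le_max_right K (J + T)).trans hjt
      omega
    exact (response_nonneg_of_mul_le_pow hε.le hε1
      hW.nonneg hdiag hanti h0 h1 (hJ j hj) htT l).1 i

section Tracking

variable {V : Type*}

theorem sum_response_succ_smul [AddCommGroup V] [Module ℝ V] (W : ℕ → Matrix ι ι ℝ) (γ : ℕ → ℝ)
    (j t : ℕ) (f : ι → V) (i : ι) :
    ∑ l, response W γ j (t + 1) i l • f l
      = ∑ p, W (j + t) i p • ∑ l, response W γ j t p l • f l
        - (γ (j + t) * retain γ j t) • f i := by
  simp only [sum_smul_sum_smul, response, Matrix.sub_apply, Matrix.smul_apply, Matrix.one_apply,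
    sub_smul, Finset.sum_sub_distrib, smul_eq_mul, mul_ite, mul_one, mul_zero, ite_smul, zero_smul,
    Finset.sum_ite_eq, Finset.mem_univ, if_true]

theorem tracking_eq_response [AddCommGroup V] [Module ℝ V] {a b s : ℕ → ι → V}
    (ha : ∀ k i, a (k + 1) i = a k i + γ k • (b k i - a k i))
    (hs : ∀ k i, s (k + 1) i = ∑ l, W k i l • s k l + (a (k + 1) i - a k i))
    (hs0 : s 0 = a 0) (k : ℕ) (i : ι) :
    s k i = ∑ l, response W γ 0 k i l • a 0 l
      + ∑ r ∈ Finset.range k, γ r • ∑ l, response W γ (r + 1) (k - 1 - r) i l • b r l := by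
  induction k generalizing i with
  | zero => simp [response, Matrix.one_apply, hs0]
  | succ k ih =>
    have hstep : ∀ r ∈ Finset.range k,
        γ r • ∑ l, response W γ (r + 1) (k + 1 - 1 - r) i l • b r l
          = ∑ p, W k i p • γ r • ∑ l, response W γ (r + 1) (k - 1 - r) p l • b r l
            - γ k • ((γ r * retain γ (r + 1) (k - 1 - r)) • b r i) := by
      intro r hr
      rw [Finset.mem_range] at hr
      rw [show k + 1 - 1 - r = (k - 1 - r) + 1 by omega, sum_response_succ_smul,
        show r + 1 + (k - 1 - r) = k by omega, smul_sub, Finset.smul_sum]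
      congr 1
      · exact Finset.sum_congr rfl fun p _ => smul_comm _ _ _
      · module
    have hnew : ∑ l, response W γ (k + 1) (k + 1 - 1 - k) i l • b k l = b k i := by
      simp [response, Matrix.one_apply]
    have hak := relaxation_eq_retain (a := fun k => a k i) (fun k => ha k i) k
    rw [Finset.sum_range_succ, Finset.sum_congr rfl hstep, hnew, sum_response_succ_smul, hs, ha,
      Finset.sum_sub_distrib, Finset.sum_comm, zero_add, ← Finset.smul_sum, mul_smul]
    simp only [ih, smul_add, Finset.sum_add_distrib, Finset.smul_sum (s := Finset.range k),
      smul_sub]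
    nth_rw 2 [hak]
    rw [smul_add, Finset.smul_sum]
    abel

theorem sum_response_eq_one (hW : ∀ k, W k ∈ doublyStochastic ℝ ι) (k : ℕ) (i : ι) :
    ∑ l, response W γ 0 k i l
      + ∑ r ∈ Finset.range k, γ r * ∑ l, response W γ (r + 1) (k - 1 - r) i l = 1 := by
  simpa using (tracking_eq_response (W := W) (γ := γ) (a := fun _ _ => (1 : ℝ))
    (b := fun _ _ => 1) (s := fun _ _ => 1) (by simp)
    (by simp [sum_row_of_mem_doublyStochastic (hW _)]) rfl k i).symm

theorem tracking_mem_of_response_nonneg [AddCommGroup V] [Module ℝ V] {H : Set V}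
    (hH : Convex ℝ H) (hW : ∀ k, W k ∈ doublyStochastic ℝ ι) (h0 : ∀ k, 0 ≤ γ k) {K : ℕ}
    (hK : ∀ j t, K ≤ j + t → ∀ i l, 0 ≤ response W γ j t i l) {a b s : ℕ → ι → V}
    (ha : ∀ k i, a (k + 1) i = a k i + γ k • (b k i - a k i))
    (hs : ∀ k i, s (k + 1) i = ∑ l, W k i l • s k l + (a (k + 1) i - a k i))
    (hs0 : s 0 = a 0) (ha0 : ∀ i, a 0 i ∈ H) (hb : ∀ k i, b k i ∈ H) {k : ℕ} (hk : K ≤ k)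
    (i : ι) : s k i ∈ H := by
  have hmem := hH.sum_mem
    (t := (Finset.univ : Finset ι).disjSum (Finset.range k ×ˢ (Finset.univ : Finset ι)))
    (w := Sum.elim (fun l => response W γ 0 k i l)
      fun p => γ p.1 * response W γ (p.1 + 1) (k - 1 - p.1) i p.2)
    (z := Sum.elim (a 0) fun p => b p.1 p.2) ?nonneg ?sum_one ?mem
  case nonneg =>
    simp only [Finset.mem_disjSum, Finset.mem_product, Finset.mem_range]
    rintro _ (⟨l, -, rfl⟩ | ⟨⟨r, l⟩, ⟨hr, -⟩, rfl⟩)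
    · exact hK 0 k (by omega) i l
    · exact mul_nonneg (h0 r) (hK _ _ (by dsimp only at hr ⊢; omega) i l)
  case sum_one =>
    simpa only [Finset.sum_disjSum, Finset.sum_product, Sum.elim_inl, Sum.elim_inr,
      Finset.mul_sum] using sum_response_eq_one hW k i
  case mem =>
    rintro (l | ⟨r, l⟩) -
    exacts [ha0 l, hb r l]
  rw [tracking_eq_response ha hs hs0 k i]
  simpa only [Finset.sum_disjSum, Finset.sum_product, Sum.elim_inl, Sum.elim_inr, mul_smul,
    ← Finset.smul_sum] using hmem

end Tracking

end Response

section NormalCone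

theorem mul_eq_zero_and_nonpos_of_forall_mul_sub_le {b l : ℝ} (hl : 0 ≤ l)
    (h : ∀ t, 0 ≤ t → b * (t - l) ≤ 0) : b * l = 0 ∧ b ≤ 0 := by
  have hb : b ≤ 0 := by simpa using h (l + 1) (by positivity)
  exact ⟨le_antisymm (mul_nonpos_of_nonpos_of_nonneg hb hl) (by simpa using h 0 le_rfl), hb⟩

theorem isClosed_orthant (m : ℕ) : IsClosed (orthant m) := by
  simp only [orthant, Set.ofPred_forall]
  exact isClosed_iInter fun k => isClosed_le continuous_const (by fun_prop)

theorem convex_orthant (m : ℕ) : Convex ℝ (orthant m) := fun v hv w hw a b ha hb _ k => by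
  simpa using add_nonneg (mul_nonneg ha (hv k)) (mul_nonneg hb (hw k))

theorem zero_mem_orthant (m : ℕ) : (0 : Vec m) ∈ orthant m := fun _ => le_rfl

theorem inner_nonpos_of_mem_orthant {m : ℕ} {v w : Vec m} (hv : v ∈ orthant m)
    (hw : ∀ k, w k ≤ 0) : inner ℝ v w ≤ 0 := by
  rw [PiLp.inner_apply]
  exact Finset.sum_nonpos fun k _ => mul_nonpos_of_nonpos_of_nonneg (hw k) (hv k)

theorem mul_eq_zero_and_nonpos_of_mem_normalCone_orthant {m : ℕ} {b l : Vec m}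
    (hb : b ∈ normalCone (orthant m) l) (k : Fin m) : b k * l k = 0 ∧ b k ≤ 0 := by
  refine mul_eq_zero_and_nonpos_of_forall_mul_sub_le (hb.1 k) fun t ht => ?_
  have hmem : WithLp.toLp 2 (Function.update (fun j => l j) k t) ∈ orthant m := fun j => by
    rcases eq_or_ne j k with rfl | hj
    · simpa using ht
    · simpa [hj] using hb.1 j
  have h := hb.2 _ hmem
  rw [PiLp.inner_apply, Fintype.sum_eq_single k fun j hj => by simp [hj]] at h
  simpa [mul_comm] using h

variable {d : ℕ} {S : Set (Vec d)}

theorem proj_spec (hcl : IsClosed S) (hne : S.Nonempty) (x : Vec d) :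
    proj S x ∈ S ∧ ∀ z ∈ S, ‖proj S x - x‖ ≤ ‖z - x‖ := by
  refine Classical.epsilon_spec (p := fun y => y ∈ S ∧ ∀ z ∈ S, ‖y - x‖ ≤ ‖z - x‖) ?_
  obtain ⟨y, hy, hxy⟩ := hcl.exists_infDist_eq_dist hne x
  refine ⟨y, hy, fun z hz => ?_⟩
  rw [← dist_eq_norm, ← dist_eq_norm, dist_comm y, dist_comm z, ← hxy]
  exact Metric.infDist_le_dist_of_mem hz

theorem sub_proj_mem_normalCone (hcl : IsClosed S) (hconv : Convex ℝ S) (hne : S.Nonempty)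
    (x : Vec d) : x - proj S x ∈ normalCone S (proj S x) := by
  obtain ⟨hp, hmin⟩ := proj_spec hcl hne x
  refine ⟨hp, (norm_eq_iInf_iff_real_inner_le_zero hconv hp).1 (le_antisymm ?_ ?_)⟩
  · have := hne.to_subtype
    refine le_ciInf fun w => ?_
    rw [norm_sub_rev, norm_sub_rev x]
    exact hmin w w.2
  · exact ciInf_le ⟨0, by rintro _ ⟨w, rfl⟩; exact norm_nonneg _⟩ (⟨proj S x, hp⟩ : S)

theorem norm_proj_sub_proj_le (hcl : IsClosed S) (hconv : Convex ℝ S) (hne : S.Nonempty)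
    (x y : Vec d) : ‖proj S x - proj S y‖ ≤ ‖x - y‖ := by
  have hx := (sub_proj_mem_normalCone hcl hconv hne x).2 _ (proj_spec hcl hne y).1
  have hy := (sub_proj_mem_normalCone hcl hconv hne y).2 _ (proj_spec hcl hne x).1
  have hfirm : ‖proj S x - proj S y‖ ^ 2 ≤ inner ℝ (x - y) (proj S x - proj S y) := by
    rw [← real_inner_self_eq_norm_sq]
    simp only [inner_sub_left, inner_sub_right] at hx hy ⊢
    linarith
  have hCS := hfirm.trans (real_inner_le_norm _ _)
  rcases (norm_nonneg (proj S x - proj S y)).eq_or_lt with h | h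
  · rw [← h]
    positivity
  · nlinarith

end NormalCone

section Stack

variable {N d : ℕ}

@[simp] theorem col_apply (f : Fin N → Vec d) (i : Fin N) : col f i = f i := rfl

theorem stack_inner (x y : Stack N d) : inner ℝ x y = ∑ i, inner ℝ (x i) (y i) :=
  PiLp.inner_apply x y

theorem norm_le_sum_norm (x : Stack N d) : ‖x‖ ≤ ∑ i, ‖x i‖ := by
  rw [PiLp.norm_eq_of_L2, Real.sqrt_le_left (Finset.sum_nonneg fun i _ => norm_nonneg _)]
  exact Finset.sum_sq_le_sq_sum_of_nonneg fun i _ => norm_nonneg _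

variable {S : Fin N → Set (Vec d)}

theorem isClosed_prodSet (hS : ∀ i, IsClosed (S i)) : IsClosed (prodSet S) := by
  simp only [prodSet, Set.ofPred_forall]
  exact isClosed_iInter fun i => (hS i).preimage (by fun_prop : Continuous fun x : Stack N d => x i)

theorem convex_prodSet (hS : ∀ i, Convex ℝ (S i)) : Convex ℝ (prodSet S) :=
  fun _ hv _ hw _ _ ha hb hab i => hS i (hv i) (hw i) ha hb hab

theorem deviate_mem_prodSet {x : Stack N d} (hx : x ∈ prodSet S) {i : Fin N} {z : Vec d}
    (hz : z ∈ S i) : AggGame.deviate i x z ∈ prodSet S := fun j => by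
  rcases eq_or_ne j i with rfl | hj
  · simpa [AggGame.deviate] using hz
  · simpa [AggGame.deviate, hj] using hx j

theorem mem_normalCone_prodSet {x a : Stack N d} :
    a ∈ normalCone (prodSet S) x ↔ ∀ i, a i ∈ normalCone (S i) (x i) := by
  refine ⟨fun ha i => ⟨ha.1 i, fun z hz => ?_⟩, fun ha => ⟨fun i => (ha i).1, fun z hz => ?_⟩⟩
  · have h := ha.2 _ (deviate_mem_prodSet ha.1 hz)
    rw [stack_inner, Fintype.sum_eq_single i fun j hj => by simp [AggGame.deviate, hj]] at h
    simpa [AggGame.deviate] using h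
  · rw [stack_inner]
    exact Finset.sum_nonpos fun i _ => (ha i).2 _ (hz i)

theorem sum_eq_natCast_smul_avg (x : Stack N d) : ∑ i, x i = (N : ℝ) • avg x := by
  rcases N.eq_zero_or_pos with rfl | hN
  · simp
  · rw [avg, one_div, smul_inv_smul₀ (by positivity)]

end Stack

theorem add_inner_gradient_le_of_convexOn {E : Type*} [NormedAddCommGroup E]
    [InnerProductSpace ℝ E] [CompleteSpace E] {S : Set E} {f : E → ℝ} (hf : ConvexOn ℝ S f)
    {x z f' : E} (hx : x ∈ S) (hz : z ∈ S) (hd : HasGradientAt f f' x) :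
    f x + inner ℝ f' (z - x) ≤ f z := by
  have hline : HasDerivAt (fun t : ℝ => x + t • (z - x)) (z - x) 0 := by
    simpa using ((hasDerivAt_id (0 : ℝ)).smul_const (z - x)).const_add x
  have hf' : HasFDerivAt f (InnerProductSpace.toDual ℝ E f') (x + (0 : ℝ) • (z - x)) := by
    simpa using hd.hasFDerivAt
  have hslope := (hf'.comp_hasDerivAt (0 : ℝ) hline).tendsto_slope_zero_right
  rw [← le_sub_iff_add_le', ← InnerProductSpace.toDual_apply_apply]
  refine le_of_tendsto hslope ?_
  filter_upwards [Ioc_mem_nhdsGT (zero_lt_one' ℝ)] with t ht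
  have hconv := hf.2 hx hz (sub_nonneg.2 ht.2) ht.1.le (sub_add_cancel 1 t)
  rw [show (1 - t) • x + t • z = x + t • (z - x) by module] at hconv
  simp only [Function.comp_apply, zero_add, zero_smul, add_zero, smul_eq_mul] at hconv ⊢
  rw [inv_mul_le_iff₀ ht.1]
  linarith

theorem eq_mean_of_complementarity {ι : Type*} [Fintype ι] [Nonempty ι] {l : ι → ℝ} {μ β : ℝ}
    (hl : ∀ i, 0 ≤ l i) (hμ : ∑ i, l i = Fintype.card ι * μ)
    (h : ∀ i, (β - (l i - μ)) * l i = 0 ∧ β - (l i - μ) ≤ 0) :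
    β ≤ 0 ∧ (∀ i, l i = μ) ∧ β * μ = 0 := by
  have hcard : (0 : ℝ) < Fintype.card ι := Nat.cast_pos.2 Fintype.card_pos
  have hconst : ∀ c : ℝ, ∑ _i : ι, c = Fintype.card ι * c := fun c => by simp
  have hβ : β ≤ 0 := by
    have hsum : ∑ _i : ι, (β + μ) ≤ ∑ i, l i :=
      Finset.sum_le_sum fun i _ => by linarith [(h i).2]
    rw [hconst, hμ] at hsum
    linarith [le_of_mul_le_mul_left hsum hcard]
  have hμ0 : 0 ≤ μ :=
    nonneg_of_mul_nonneg_right (hμ ▸ Finset.sum_nonneg fun i _ => hl i) hcard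
  have hle : ∀ i, l i ≤ μ := fun i => by
    rcases mul_eq_zero.1 (h i).1 with h0 | h0 <;> linarith
  have heq : ∀ i, l i = μ := fun i =>
    (Finset.sum_eq_sum_iff_of_le fun i _ => hle i).1 (hμ.trans (hconst μ).symm) i
      (Finset.mem_univ i)
  refine ⟨hβ, heq, ?_⟩
  simpa [heq] using (h (Classical.arbitrary ι)).1

namespace AggGame

variable {N n m : ℕ} {g : AggGame N n m}

/-- Convexity, compactness and joint differentiability of the game data. -/
structure Regular (g : AggGame N n m) : Prop where
  compact : ∀ i, IsCompact (g.Ω i)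
  convex : ∀ i, Convex ℝ (g.Ω i)
  cost_convex : ∀ i, ∀ x ∈ prodSet g.Ω, ConvexOn ℝ (g.Ω i) (g.ownCost i (others i x))
  joint_diff : ∀ i, ∀ v ∈ g.Ω i, ∀ w ∈ g.hull,
    DifferentiableAt ℝ (fun p : Vec n × Vec n => g.J i p.1 p.2) (v, w)

theorem Standard.regular (hg : g.Standard) : g.Regular :=
  ⟨hg.compact, hg.convex, hg.cost_convex, hg.joint_diff⟩

theorem avg_eq_add_others (x : Stack N n) (i : Fin N) :
    avg x = (1 / (N : ℝ)) • x i + others i x := by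
  rw [avg, others, ← smul_add, Finset.add_sum_erase _ _ (Finset.mem_univ i)]

theorem avg_mem_hull [NeZero N] {x : Stack N n} (hx : x ∈ prodSet g.Ω) : avg x ∈ g.hull := by
  rw [avg, Finset.smul_sum]
  refine (convex_convexHull ℝ _).sum_mem (fun i _ => by positivity) ?_ fun i _ =>
    subset_convexHull ℝ _ (Set.mem_iUnion.2 ⟨i, hx i⟩)
  simp [NeZero.ne N]

theorem hasGradientAt_ownCost {i : Fin N} {u v : Vec n}
    (hd : DifferentiableAt ℝ (fun p : Vec n × Vec n => g.J i p.1 p.2)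
      (v, (1 / (N : ℝ)) • v + u)) :
    HasGradientAt (g.ownCost i u) (g.partialGrad i v ((1 / (N : ℝ)) • v + u)) v := by
  obtain ⟨D, hD⟩ := hd
  have hfst : HasFDerivAt (fun z => g.J i z ((1 / (N : ℝ)) • v + u)) (D ∘L .inl ℝ _ _) v :=
    HasFDerivAt.comp (f := fun z => (z, (1 / (N : ℝ)) • v + u)) v hD
      (hasFDerivAt_prodMk_left (𝕜 := ℝ) v _)
  have hsnd : HasFDerivAt (fun w => g.J i v w) (D ∘L .inr ℝ _ _) ((1 / (N : ℝ)) • v + u) :=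
    hD.comp _ (hasFDerivAt_prodMk_right v _)
  have hpair : HasFDerivAt (fun z : Vec n => (z, (1 / (N : ℝ)) • z + u))
      ((ContinuousLinearMap.id ℝ (Vec n)).prod
        ((1 / (N : ℝ)) • ContinuousLinearMap.id ℝ (Vec n))) v :=
    (hasFDerivAt_id v).prodMk (((hasFDerivAt_id v).const_smul (1 / (N : ℝ))).add_const u)
  refine (HasFDerivAt.comp (g := fun p : Vec n × Vec n => g.J i p.1 p.2) v hD
    hpair).congr_fderiv ?_
  ext z
  rw [InnerProductSpace.toDual_apply_apply, partialGrad, inner_add_left, real_inner_smul_left,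
    gradient, gradient, hfst.fderiv, hsnd.fderiv]
  have hsplit : ((z, (1 / (N : ℝ)) • z) : Vec n × Vec n) = (z, 0) + (1 / (N : ℝ)) • (0, z) := by
    simp
  simp only [InnerProductSpace.toDual_symm_apply, ContinuousLinearMap.comp_apply,
    ContinuousLinearMap.prod_apply, ContinuousLinearMap.inl_apply, ContinuousLinearMap.inr_apply,
    ContinuousLinearMap.id_apply, smul_apply, hsplit, map_add, map_smul,
    smul_eq_mul]

theorem Regular.hasGradientAt_ownCost [NeZero N] (hg : g.Regular) {x : Stack N n}
    (hx : x ∈ prodSet g.Ω) (i : Fin N) :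
    HasGradientAt (g.ownCost i (others i x)) (g.partialGrad i (x i) (avg x)) (x i) := by
  have h := avg_eq_add_others x i
  rw [h]
  exact AggGame.hasGradientAt_ownCost (hg.joint_diff i _ (hx i) _ (h ▸ avg_mem_hull hx))

theorem Regular.pseudoGrad_apply [NeZero N] (hg : g.Regular) {x : Stack N n}
    (hx : x ∈ prodSet g.Ω) (i : Fin N) : g.pseudoGrad x i = g.partialGrad i (x i) (avg x) :=
  (hg.hasGradientAt_ownCost hx i).gradient

theorem coupling_deviate (x : Stack N n) (i : Fin N) (z : Vec n) :
    g.coupling (deviate i x z) = g.coupling x + g.C i (z - x i) := by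
  rw [coupling, coupling, ← sub_eq_iff_eq_add', ← Finset.sum_sub_distrib,
    Fintype.sum_eq_single i fun j hj => by simp [deviate, hj]]
  simp [deviate]

theorem Regular.isGNE_of_isKKT [NeZero N] (hg : g.Regular) {x : Stack N n} {l : Stack N m}
    (h : g.IsKKT x l) : g.IsGNE x := by
  have hx : x ∈ prodSet g.Ω := fun i => (h i).1.choose_spec.1.1
  refine ⟨⟨hx, (h 0).2.2.1⟩, fun i z hz => ?_⟩
  obtain ⟨⟨v, hv, hstat⟩, hl, -, hcompl⟩ := h i
  have hzi : z ∈ g.Ω i := by simpa [deviate] using hz.1 i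
  have hgrad := add_inner_gradient_le_of_convexOn (hg.cost_convex i x hx) (hx i) hzi
    (hg.hasGradientAt_ownCost hx i)
  have hmult : inner ℝ (l i) (g.C i (z - x i)) ≤ 0 := by
    have hCz : g.C i (z - x i) = g.coupling (deviate i x z) - g.coupling x := by
      rw [coupling_deviate, add_sub_cancel_left]
    rw [hCz, inner_sub_right, hcompl, sub_zero]
    exact inner_nonpos_of_mem_orthant hl hz.2
  have hpg : g.partialGrad i (x i) (avg x) = -v - (g.C i).adjoint (l i) := by
    rw [← hg.pseudoGrad_apply hx, eq_sub_iff_add_eq, eq_neg_iff_add_eq_zero, ← hstat]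
    abel
  rw [hpg, inner_sub_left, inner_neg_left, ContinuousLinearMap.adjoint_inner_left, ownCost,
    ownCost, ← avg_eq_add_others] at hgrad
  linarith [hv.2 z hzi]

theorem isZeroT_iff {x : Stack N n} {l : Stack N m} :
    g.IsZeroT x l ↔
      -(g.pseudoGrad x + col fun i => (g.C i).adjoint (avg l)) ∈ normalCone (prodSet g.Ω) x ∧
      -(col fun i => l i - avg l - (1 / (N : ℝ)) • g.coupling x) ∈
        normalCone (prodSet fun _ => orthant m) l := by
  have hdual : (1 / (N : ℝ)) • col (fun i => (g.C i).adjoint (∑ j, l j))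
      = col fun i => (g.C i).adjoint (avg l) := by
    ext1 i
    simp only [PiLp.smul_apply, col_apply, avg, map_smul]
  have hcons : (col fun i => l i - avg l) - (1 / (N : ℝ)) • col (fun _ => g.coupling x)
      = col fun i => l i - avg l - (1 / (N : ℝ)) • g.coupling x := rfl
  constructor
  · rintro ⟨a, ha, b, hb, h1, h2⟩
    dsimp only at h1 h2
    rw [hdual, add_assoc] at h1
    rw [add_sub_assoc, hcons] at h2
    exact ⟨eq_neg_of_add_eq_zero_left h1.symm ▸ ha, eq_neg_of_add_eq_zero_left h2.symm ▸ hb⟩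
  · rintro ⟨ha, hb⟩
    refine ⟨_, ha, _, hb, ?_, ?_⟩ <;> dsimp only
    · rw [hdual, add_assoc, neg_add_cancel]
    · rw [add_sub_assoc, hcons, neg_add_cancel]

theorem IsZeroT.complementarity [NeZero N] {x : Stack N n} {l : Stack N m} (h : g.IsZeroT x l)
    (k : Fin m) : g.coupling x k ≤ 0 ∧ (∀ i, l i k = avg l k) ∧
      g.coupling x k * avg l k = 0 := by
  have hN : (0 : ℝ) < N := Nat.cast_pos.2 (NeZero.pos N)
  have hdual := mem_normalCone_prodSet.1 (isZeroT_iff.1 h).2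
  obtain ⟨hle, heq, hmul⟩ := eq_mean_of_complementarity (l := fun i => l i k)
    (μ := avg l k) (β := 1 / (N : ℝ) * g.coupling x k) (fun i => (hdual i).1 k)
    (by simpa using congrArg (fun v : Vec m => v k) (sum_eq_natCast_smul_avg l)) fun i => by
      simpa using mul_eq_zero_and_nonpos_of_mem_normalCone_orthant (hdual i) k
  rw [mul_assoc] at hmul
  exact ⟨nonpos_of_mul_nonpos_right hle (one_div_pos.2 hN), heq,
    (mul_eq_zero.1 hmul).resolve_left (one_div_pos.2 hN).ne'⟩

theorem IsZeroT.isKKT [NeZero N] {x : Stack N n} {l : Stack N m} (h : g.IsZeroT x l) :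
    g.IsKKT x (col fun _ => avg l) := by
  obtain ⟨hprimal, hdual⟩ := isZeroT_iff.1 h
  refine fun i => ⟨⟨_, mem_normalCone_prodSet.1 hprimal i, ?_⟩, fun k => ?_,
    fun k => (h.complementarity k).1, ?_⟩
  · simp
  · rw [col_apply, ← (h.complementarity k).2.1 0]
    exact hdual.1 0 k
  · rw [PiLp.inner_apply]
    exact Finset.sum_eq_zero fun k _ => (h.complementarity k).2.2

theorem Regular.isVariationalGNE_of_isZeroT [NeZero N] (hg : g.Regular) {x : Stack N n}
    {l : Stack N m} (h : g.IsZeroT x l) : g.IsVariationalGNE x :=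
  ⟨hg.isGNE_of_isKKT h.isKKT, avg l, h.isKKT⟩

end AggGame

section Average

variable {N d : ℕ}

theorem avg_add (x y : Stack N d) : avg (x + y) = avg x + avg y := by
  simp [avg, Finset.sum_add_distrib]

theorem avg_smul (r : ℝ) (x : Stack N d) : avg (r • x) = r • avg x := by
  simp [avg, ← Finset.smul_sum, smul_comm r]

theorem avg_sub (x y : Stack N d) : avg (x - y) = avg x - avg y := by
  simp [avg, smul_sub]

theorem inner_col_const (v : Vec d) (l : Stack N d) :
    inner ℝ (col fun _ : Fin N => (1 / (N : ℝ)) • v) l = inner ℝ v (avg l) := by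
  simp only [stack_inner, col_apply, avg, real_inner_smul_left, real_inner_smul_right, inner_sum,
    Finset.mul_sum]

theorem inner_sub_avg_self (l : Stack N d) :
    inner ℝ (col fun i => l i - avg l) l = ‖(col fun i => l i - avg l : Stack N d)‖ ^ 2 := by
  have horth : inner ℝ (col fun i => l i - avg l : Stack N d) (col fun _ => avg l) = 0 := by
    simp only [stack_inner, col_apply, ← sum_inner]
    rw [Finset.sum_sub_distrib, sum_eq_natCast_smul_avg]
    simp [Nat.cast_smul_eq_nsmul]
  have hsplit : l = (col fun i => l i - avg l) + col fun _ => avg l := PiLp.ext fun i => by simp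
  nth_rw 3 [hsplit]
  rw [inner_add_right, horth, add_zero, real_inner_self_eq_norm_sq]

end Average

/-- Primal-dual pairs `(x, λ)` with the Euclidean norm. -/
abbrev PrimalDual (N n m : ℕ) := WithLp 2 (Stack N n × Stack N m)

section PrimalDual

variable {N n m : ℕ}

theorem primalDual_ext {v w : PrimalDual N n m} (h1 : ∀ i, v.fst i = w.fst i)
    (h2 : ∀ i, v.snd i = w.snd i) : v = w :=
  WithLp.ofLp_injective 2 (Prod.ext (PiLp.ext h1) (PiLp.ext h2))

theorem primalDual_inner (v w : PrimalDual N n m) :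
    inner ℝ v w = inner ℝ v.fst w.fst + inner ℝ v.snd w.snd := WithLp.prod_inner_apply v w

theorem norm_primalDual_le (w : PrimalDual N n m) : ‖w‖ ≤ ‖w.fst‖ + ‖w.snd‖ := by
  rw [WithLp.prod_norm_eq_of_L2]
  exact Real.sqrt_le_iff.2 ⟨by positivity, by nlinarith [norm_nonneg w.fst, norm_nonneg w.snd]⟩

theorem mem_normalCone_primalDual {S : Set (Stack N n)} {T : Set (Stack N m)}
    {v w : PrimalDual N n m} :
    v ∈ normalCone {u : PrimalDual N n m | u.fst ∈ S ∧ u.snd ∈ T} w ↔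
      v.fst ∈ normalCone S w.fst ∧ v.snd ∈ normalCone T w.snd := by
  constructor
  · rintro ⟨⟨hw1, hw2⟩, h⟩
    refine ⟨⟨hw1, fun z hz => ?_⟩, hw2, fun z hz => ?_⟩
    · simpa [primalDual_inner] using h (WithLp.toLp 2 (z, w.snd)) ⟨hz, hw2⟩
    · simpa [primalDual_inner] using h (WithLp.toLp 2 (w.fst, z)) ⟨hw1, hz⟩
  · rintro ⟨⟨hw1, h1⟩, hw2, h2⟩
    refine ⟨⟨hw1, hw2⟩, fun z hz => ?_⟩
    rw [primalDual_inner]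
    exact add_nonpos (h1 _ hz.1) (h2 _ hz.2)

end PrimalDual

namespace AggGame

variable {N n m : ℕ} (g : AggGame N n m)

/-- The pairs `(x, λ)` with `x ∈ ∏ Ω_i` and `λ ≥ 0`. -/
def primalDualSet : Set (PrimalDual N n m) :=
  {w | w.fst ∈ prodSet g.Ω ∧ w.snd ∈ prodSet fun _ => orthant m}

/-- `∑_i C_i x_i`. -/
def total (x : Stack N n) : Vec m := ∑ i, g.C i (x i)

theorem total_add (x y : Stack N n) : g.total (x + y) = g.total x + g.total y := by
  simp [total, Finset.sum_add_distrib]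

theorem total_smul (r : ℝ) (x : Stack N n) : g.total (r • x) = r • g.total x := by
  simp [total, Finset.smul_sum]

theorem total_sub (x y : Stack N n) : g.total (x - y) = g.total x - g.total y := by
  simp [total]

theorem coupling_eq_total (x : Stack N n) : g.coupling x = g.total x - ∑ i, g.c i := by
  simp [coupling, total]

theorem inner_col_adjoint (v : Vec m) (x : Stack N n) :
    inner ℝ (col fun i => (g.C i).adjoint v) x = inner ℝ v (g.total x) := by
  simp only [stack_inner, total, inner_sum, col_apply, ContinuousLinearMap.adjoint_inner_left]

/-- `(x, λ) ↦ (col (C_iᵀ λ̄), s N⁻¹ C x)`; skew-symmetric for `s = -1`, symmetric for `s = 1`. -/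
noncomputable def couplingOp (s : ℝ) : PrimalDual N n m →ₗ[ℝ] PrimalDual N n m where
  toFun w := WithLp.toLp 2 (col fun i => (g.C i).adjoint (avg w.snd),
    s • col fun _ => (1 / (N : ℝ)) • g.total w.fst)
  map_add' v w := primalDual_ext (fun i => by simp [avg_add]) (fun i => by simp [total_add])
  map_smul' r w := primalDual_ext (fun i => by simp [avg_smul]) fun i => by
    simp only [WithLp.toLp_snd, PiLp.smul_apply, col_apply, WithLp.smul_fst, WithLp.smul_snd,
      total_smul, RingHom.id_apply, smul_comm r]

theorem inner_couplingOp (s : ℝ) (v w : PrimalDual N n m) :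
    inner ℝ (g.couplingOp s v) w
      = inner ℝ (avg v.snd) (g.total w.fst) + s * inner ℝ (g.total v.fst) (avg w.snd) := by
  rw [primalDual_inner]
  simp only [couplingOp, LinearMap.coe_mk, AddHom.coe_mk, WithLp.toLp_fst, WithLp.toLp_snd]
  rw [inner_col_adjoint, real_inner_smul_left, inner_col_const]

/-- The preconditioner `diag(α_i⁻¹, β_i⁻¹) - couplingOp 1`. Subtracting the symmetric coupling
cancels the simultaneous coupling of the two resolvents, so that the dual update may use the new
primal point. -/
noncomputable def precond (α β : Fin N → ℝ) : PrimalDual N n m →ₗ[ℝ] PrimalDual N n m where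
  toFun w := WithLp.toLp 2 (col fun i => (α i)⁻¹ • w.fst i, col fun i => (β i)⁻¹ • w.snd i)
    - g.couplingOp 1 w
  map_add' v w := by
    rw [map_add, ← add_sub_add_comm]
    congr 1
    exact primalDual_ext (fun i => by simp) (fun i => by simp)
  map_smul' r w := by
    rw [map_smul, RingHom.id_apply, smul_sub]
    congr 1
    exact primalDual_ext (fun i => by simp [smul_comm r]) (fun i => by simp [smul_comm r])

theorem inner_precond (α β : Fin N → ℝ) (v w : PrimalDual N n m) :
    inner ℝ (g.precond α β v) w = ∑ i, (α i)⁻¹ * inner ℝ (v.fst i) (w.fst i)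
      + ∑ i, (β i)⁻¹ * inner ℝ (v.snd i) (w.snd i)
      - (inner ℝ (avg v.snd) (g.total w.fst) + inner ℝ (g.total v.fst) (avg w.snd)) := by
  simp only [precond, LinearMap.coe_mk, AddHom.coe_mk]
  rw [inner_sub_left, inner_couplingOp, one_mul, primalDual_inner]
  simp only [WithLp.toLp_fst, WithLp.toLp_snd, stack_inner, col_apply, real_inner_smul_left]

theorem isSymmetric_precond (α β : Fin N → ℝ) : (g.precond α β).IsSymmetric := fun v w => by
  rw [real_inner_comm (g.precond α β w) v, inner_precond, inner_precond,
    real_inner_comm (avg v.snd), real_inner_comm (g.total v.fst)]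
  simp only [real_inner_comm (v.fst _), real_inner_comm (v.snd _)]
  ring

theorem two_mul_inner_map_le {E F : Type*} [NormedAddCommGroup E] [NormedSpace ℝ E]
    [NormedAddCommGroup F] [InnerProductSpace ℝ F] (L : E →L[ℝ] F) (x : E) (y : F) :
    2 * inner ℝ (L x) y ≤ ‖L‖ * ‖x‖ ^ 2 + ‖L‖ * ‖y‖ ^ 2 := by
  have hCS := (real_inner_le_norm (L x) y).trans
    (mul_le_mul_of_nonneg_right (L.le_opNorm x) (norm_nonneg y))
  nlinarith [mul_nonneg (norm_nonneg L) (sq_nonneg (‖x‖ - ‖y‖))]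

theorem two_mul_inner_total_avg_le [NeZero N] (x : Stack N n) (l : Stack N m) :
    2 * inner ℝ (g.total x) (avg l)
      ≤ ∑ i, ‖g.C i‖ * ‖x i‖ ^ 2 + 1 / (N : ℝ) * (∑ j, ‖g.C j‖) * ∑ i, ‖l i‖ ^ 2 := by
  have hN : (N : ℝ) ≠ 0 := NeZero.ne _
  calc 2 * inner ℝ (g.total x) (avg l)
      = 1 / (N : ℝ) * ∑ i, ∑ j, 2 * inner ℝ (g.C i (x i)) (l j) := by
        simp only [total, avg, real_inner_smul_right, sum_inner, inner_sum, ← Finset.mul_sum]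
        rw [Finset.sum_comm]
        ring
    _ ≤ 1 / (N : ℝ) * ∑ i, ∑ j, (‖g.C i‖ * ‖x i‖ ^ 2 + ‖g.C i‖ * ‖l j‖ ^ 2) := by
        gcongr with i _ j _
        exact two_mul_inner_map_le _ _ _
    _ = _ := by
        simp only [Finset.sum_add_distrib, Finset.sum_const, Finset.card_univ, Fintype.card_fin,
          nsmul_eq_mul, ← Finset.mul_sum, ← Finset.sum_mul]
        field_simp

variable {g}

theorem StepSizes.add_le_inv_α {χ δ τ : ℝ} {α β : Fin N → ℝ} (h : g.StepSizes χ δ τ α β)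
    (i : Fin N) : ‖g.C i‖ + τ ≤ (α i)⁻¹ := by
  simpa only [inv_inv] using inv_anti₀ (h.α_pos i) (h.α_le i)

theorem StepSizes.add_le_inv_β {χ δ τ : ℝ} {α β : Fin N → ℝ} (h : g.StepSizes χ δ τ α β)
    (i : Fin N) : 1 / (N : ℝ) * ∑ j, ‖g.C j‖ + τ ≤ (β i)⁻¹ := by
  simpa only [inv_inv] using inv_anti₀ (h.β_pos i) (h.β_le i)

theorem StepSizes.le_inner_precond [NeZero N] {χ δ τ : ℝ} {α β : Fin N → ℝ}
    (h : g.StepSizes χ δ τ α β) (w : PrimalDual N n m) :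
    τ * ‖w‖ ^ 2 ≤ inner ℝ (g.precond α β w) w := by
  have hcross := g.two_mul_inner_total_avg_le w.fst w.snd
  have hx : ∑ i, (‖g.C i‖ + τ) * ‖w.fst i‖ ^ 2 ≤ ∑ i, (α i)⁻¹ * ‖w.fst i‖ ^ 2 :=
    Finset.sum_le_sum fun i _ => mul_le_mul_of_nonneg_right (h.add_le_inv_α i) (by positivity)
  have hl : ∑ i, (1 / (N : ℝ) * ∑ j, ‖g.C j‖ + τ) * ‖w.snd i‖ ^ 2
      ≤ ∑ i, (β i)⁻¹ * ‖w.snd i‖ ^ 2 :=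
    Finset.sum_le_sum fun i _ => mul_le_mul_of_nonneg_right (h.add_le_inv_β i) (by positivity)
  rw [WithLp.prod_norm_sq_eq_of_L2, PiLp.norm_sq_eq_of_L2, PiLp.norm_sq_eq_of_L2, inner_precond,
    real_inner_comm (g.total w.fst), mul_add]
  simp only [real_inner_self_eq_norm_sq, add_mul, Finset.sum_add_distrib, ← Finset.mul_sum]
    at hx hl ⊢
  linarith

variable (g) in
/-- The cocoercive part of `T`. -/
noncomputable def forwardOp (w : PrimalDual N n m) : PrimalDual N n m :=
  WithLp.toLp 2 (g.pseudoGrad w.fst,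
    col fun i => w.snd i - avg w.snd + (1 / (N : ℝ)) • ∑ j, g.c j)

theorem isCocoerciveOn_forwardOp {χ δ : ℝ} (hδ : δ ≤ min 1 χ) (hF : g.Cocoercive χ) :
    IsCocoerciveOn δ g.forwardOp g.primalDualSet := by
  intro v hv w hw
  have hsub : g.forwardOp v - g.forwardOp w = WithLp.toLp 2
      (g.pseudoGrad v.fst - g.pseudoGrad w.fst,
        col fun i => (v.snd - w.snd) i - avg (v.snd - w.snd)) := by
    refine primalDual_ext (fun i => by simp [forwardOp]) (fun i => ?_)
    simp only [forwardOp, WithLp.sub_snd, WithLp.toLp_snd, PiLp.sub_apply, col_apply, avg_sub]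
    abel
  rw [hsub, primalDual_inner, WithLp.prod_norm_sq_eq_of_L2]
  simp only [WithLp.toLp_fst, WithLp.toLp_snd, WithLp.sub_fst, WithLp.sub_snd]
  rw [inner_sub_avg_self, mul_add]
  refine add_le_add (le_trans ?_ (hF _ hv.1 _ hw.1)) ?_
  · exact mul_le_mul_of_nonneg_right (hδ.trans (min_le_right _ _)) (by positivity)
  · exact mul_le_of_le_one_left (by positivity) (hδ.trans (min_le_left _ _))

theorem Regular.isPreconditionedSplitting [NeZero N] (hg : g.Regular) {χ δ τ : ℝ}
    {α β : Fin N → ℝ} (hF : g.Cocoercive χ) (h : g.StepSizes χ δ τ α β) :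
    IsPreconditionedSplitting g.primalDualSet (g.precond α β) (g.couplingOp (-1)) g.forwardOp
      δ τ where
  isClosed :=
    ((isClosed_prodSet fun i => (hg.compact i).isClosed).preimage
      (by fun_prop : Continuous fun w : PrimalDual N n m => w.fst)).inter
    ((isClosed_prodSet fun _ => isClosed_orthant m).preimage
      (by fun_prop : Continuous fun w : PrimalDual N n m => w.snd))
  convex := fun _ hv _ hw _ _ ha hb hab =>
    ⟨convex_prodSet hg.convex hv.1 hw.1 ha hb hab,
      convex_prodSet (fun _ => convex_orthant m) hv.2 hw.2 ha hb hab⟩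
  δ_pos := h.δ_pos
  τ_gt := h.τ_gt
  isSymmetric := g.isSymmetric_precond α β
  coercive := h.le_inner_precond
  skew := fun w => by
    rw [inner_couplingOp, real_inner_comm]
    ring
  cocoercive := isCocoerciveOn_forwardOp h.δ_le hF

theorem neg_add_mem_normalCone_iff_isZeroT {w : PrimalDual N n m} :
    -(g.forwardOp w + g.couplingOp (-1) w) ∈ normalCone g.primalDualSet w ↔
      g.IsZeroT w.fst w.snd := by
  have hsnd : (g.forwardOp w + g.couplingOp (-1) w).snd
      = col fun i => w.snd i - avg w.snd - (1 / (N : ℝ)) • g.coupling w.fst := by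
    ext1 i
    simp only [forwardOp, couplingOp, LinearMap.coe_mk, AddHom.coe_mk, WithLp.add_snd,
      WithLp.toLp_snd, PiLp.add_apply, PiLp.smul_apply, col_apply, coupling_eq_total]
    module
  rw [isZeroT_iff, ← hsnd, primalDualSet, mem_normalCone_primalDual]
  rfl

end AggGame

theorem summable_mul_of_eventually_le {γ f h : ℕ → ℝ} (hγ : ∀ k, 0 ≤ γ k) (hf : ∀ k, 0 ≤ f k)
    (hfh : ∀ᶠ k in atTop, f k ≤ h k) (hs : Summable fun k => γ k * h k) :
    Summable fun k => γ k * f k := by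
  refine Summable.of_norm_bounded_eventually_nat hs ?_
  filter_upwards [hfh] with k hk
  rw [Real.norm_of_nonneg (mul_nonneg (hγ k) (hf k))]
  exact mul_le_mul_of_nonneg_left hk (hγ k)

namespace VanishingSteps

variable {γ : ℕ → ℝ} (h : VanishingSteps γ)
include h

theorem tendsto_zero : Tendsto γ atTop (𝓝 0) := by
  simpa only [Real.sqrt_sq (h.nonneg _), Real.sqrt_zero]
    using h.sq_summable.tendsto_atTop_zero.sqrt

variable {E : Type*} [SeminormedAddCommGroup E] [NormedSpace ℝ E] {w wt : ℕ → E} {R Rt : ℝ}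
  (hw : ∀ k, w (k + 1) = w k + γ k • (wt k - w k)) (hR : ∀ k, ‖w k‖ ≤ R) (hRt : ∀ k, ‖wt k‖ ≤ Rt)
include hw hR hRt

theorem norm_increment_le (k : ℕ) : ‖w (k + 1) - w k‖ ≤ γ k * (Rt + R) := by
  rw [hw, add_sub_cancel_left, norm_smul, Real.norm_of_nonneg (h.nonneg k)]
  exact mul_le_mul_of_nonneg_left ((norm_sub_le _ _).trans (add_le_add (hRt k) (hR k))) (h.nonneg k)

theorem tendsto_norm_increment : Tendsto (fun k => ‖w (k + 1) - w k‖) atTop (𝓝 0) :=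
  squeeze_zero (fun _ => norm_nonneg _) (h.norm_increment_le hw hR hRt)
    (by simpa using h.tendsto_zero.mul_const (Rt + R))

theorem summable_mul_norm_increment : Summable fun k => γ k * ‖w (k + 1) - w k‖ :=
  summable_mul_of_eventually_le h.nonneg (fun _ => norm_nonneg _)
    (Eventually.of_forall (h.norm_increment_le hw hR hRt))
    ((h.sq_summable.mul_right (Rt + R)).congr fun k => by ring)

end VanishingSteps

section Mixing

variable {N d : ℕ}

/-- The distance of a stacked vector from consensus. -/
noncomputable def disagreement (v : Stack N d) : ℝ := ‖v - col fun _ => avg v‖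

theorem disagreement_nonneg (v : Stack N d) : 0 ≤ disagreement v := norm_nonneg _

theorem norm_col_avg_le (v : Stack N d) : ‖(col fun _ => avg v : Stack N d)‖ ≤ ‖v‖ := by
  set u : Stack N d := col fun _ => avg v
  have hself : inner ℝ u v = ‖u‖ ^ 2 := by
    rw [← real_inner_self_eq_norm_sq, stack_inner, stack_inner]
    simp only [u, col_apply, ← inner_sum, sum_eq_natCast_smul_avg v, Finset.sum_const,
      Finset.card_univ, Fintype.card_fin, ← Nat.cast_smul_eq_nsmul ℝ]
  nlinarith [real_inner_le_norm u v, norm_nonneg u, norm_nonneg v]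

theorem norm_le_disagreement_add (v : Stack N d) :
    ‖v‖ ≤ disagreement v + ‖(col fun _ => avg v : Stack N d)‖ :=
  norm_le_norm_sub_add v _

variable {w : Matrix (Fin N) (Fin N) ℝ} (hw : w ∈ doublyStochastic ℝ (Fin N))
include hw

theorem avg_mix (v : Stack N d) : avg (mix w v) = avg v := by
  simp only [avg, mix, col_apply]
  rw [Finset.sum_comm]
  simp only [← Finset.sum_smul, sum_col_of_mem_doublyStochastic hw, one_smul]

theorem norm_mix_le (v : Stack N d) : ‖mix w v‖ ≤ ‖v‖ := by
  have hconv : ConvexOn ℝ Set.univ ((fun u : Vec d => ‖u‖) ^ 2) :=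
    (convexOn_norm convex_univ).pow (fun _ _ => norm_nonneg _) 2
  rw [← sq_le_sq₀ (norm_nonneg _) (norm_nonneg _), PiLp.norm_sq_eq_of_L2, PiLp.norm_sq_eq_of_L2]
  calc ∑ i, ‖mix w v i‖ ^ 2 ≤ ∑ i, ∑ j, w i j * ‖v j‖ ^ 2 := Finset.sum_le_sum fun i _ =>
        hconv.map_sum_le (fun j _ => nonneg_of_mem_doublyStochastic hw)
          (sum_row_of_mem_doublyStochastic hw i) fun _ _ => Set.mem_univ _
    _ = ∑ j, ‖v j‖ ^ 2 := by
        rw [Finset.sum_comm]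
        simp only [← Finset.sum_mul, sum_col_of_mem_doublyStochastic hw, one_mul]

theorem norm_mix_sub_avg_le (v : Stack N d) :
    ‖mix w v - col fun _ => avg v‖ ≤ disagreement v := by
  have hshift : mix w v - col (fun _ => avg v) = mix w (v - col fun _ => avg v) := by
    ext1 i
    simp only [mix, PiLp.sub_apply, col_apply, smul_sub, Finset.sum_sub_distrib,
      ← Finset.sum_smul, sum_row_of_mem_doublyStochastic hw, one_smul]
  rw [hshift]
  exact norm_mix_le hw _

end Mixing

/-- The variables `v` track the average of the sequence `p` by dynamic average consensus. -/
structure TracksAverage {N d : ℕ} (W : ℕ → Matrix (Fin N) (Fin N) ℝ) (p v : ℕ → Stack N d) :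
    Prop where
  init : v 0 = p 0
  succ : ∀ k, v (k + 1) = mix (W k) (v k) + (p (k + 1) - p k)

namespace TracksAverage

variable {N d : ℕ} {W : ℕ → Matrix (Fin N) (Fin N) ℝ} {C ρ : ℝ} {p v : ℕ → Stack N d}
  (h : TracksAverage W p v) (hW : MixesGeometrically W C ρ)
include h hW

theorem avg_eq (k : ℕ) : avg (v k) = avg (p k) := by
  induction k with
  | zero => rw [h.init]
  | succ k ih =>
    rw [h.succ, avg_add, avg_mix (hW.mem_doublyStochastic k), ih, avg_sub, add_sub_cancel]

theorem exists_disagreement_le : ∃ b : ℕ → ℝ, (∀ k, 0 ≤ b k) ∧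
    (∀ k, b (k + 1) ≤ ρ * b k + N * C * N * ‖p (k + 1) - p k‖) ∧
    ∀ k, disagreement (v k) ≤ b k := by
  set f : ℕ → ℝ := fun r => ∑ l, ‖p (r + 1) l - p r l‖
  have hC := hW.C_pos
  have hρ := hW.ρ_pos
  have hf : ∀ k, f k ≤ N * ‖p (k + 1) - p k‖ := fun k => by
    simpa using Finset.sum_le_card_nsmul Finset.univ _ _
      fun l _ => PiLp.norm_apply_le (p (k + 1) - p k) l
  refine ⟨fun k => N * C * (ρ ^ k * ∑ l, ‖v 0 l‖ + geomConv ρ f k), fun k => ?_, fun k => ?_,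
    fun k => ?_⟩
  · have := geomConv_nonneg hρ.le (f := f) (fun r => Finset.sum_nonneg fun _ _ => norm_nonneg _) k
    positivity
  · simp only [geomConv_succ, pow_succ]
    linear_combination (N * C : ℝ) * hf k
  · have hblock := norm_sub_mean_le hW (j := 0) (v := fun k i => v k i)
      (u := fun k i => p (k + 1) i - p k i) (fun t i => by simp [h.succ, mix]) k
    rw [Fintype.card_fin] at hblock
    refine (norm_le_sum_norm _).trans ((Finset.sum_le_sum fun i _ => hblock i).trans_eq ?_)
    simp [f, mul_assoc]

theorem exists_disagreement_le_const {M : ℝ} (hM : ∀ k, ‖p k‖ ≤ M) :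
    ∃ R, ∀ k, disagreement (v k) ≤ R := by
  obtain ⟨b, -, hb, hle⟩ := h.exists_disagreement_le hW
  have hC := hW.C_pos
  have hinc : BddAbove (Set.range fun k => N * C * N * ‖p (k + 1) - p k‖) := by
    refine ⟨N * C * N * (M + M), Set.forall_mem_range.2 fun k => ?_⟩
    gcongr
    exact (norm_sub_le _ _).trans (add_le_add (hM _) (hM _))
  obtain ⟨R, hR⟩ := bddAbove_of_contraction hW.ρ_pos.le hW.ρ_lt_one hb hinc
  exact ⟨R, fun k => (hle k).trans (hR ⟨k, rfl⟩)⟩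

theorem exists_norm_le {M : ℝ} (hM : ∀ k, ‖p k‖ ≤ M) : ∃ R, ∀ k, ‖v k‖ ≤ R := by
  obtain ⟨R, hR⟩ := h.exists_disagreement_le_const hW hM
  refine ⟨R + M, fun k => (norm_le_disagreement_add _).trans (add_le_add (hR k) ?_)⟩
  rw [h.avg_eq hW]
  exact (norm_col_avg_le _).trans (hM k)

theorem tendsto_disagreement (hp : Tendsto (fun k => ‖p (k + 1) - p k‖) atTop (𝓝 0)) :
    Tendsto (fun k => disagreement (v k)) atTop (𝓝 0) := by
  obtain ⟨b, hb0, hb, hle⟩ := h.exists_disagreement_le hW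
  exact squeeze_zero (fun k => disagreement_nonneg _) hle (tendsto_zero_of_contraction hW.ρ_pos.le
    hW.ρ_lt_one hb0 hb (by simpa using hp.const_mul (N * C * N : ℝ)))

theorem summable_mul_disagreement {γ : ℕ → ℝ} (h0 : ∀ k, 0 ≤ γ k) (hanti : Antitone γ)
    (hs : Summable fun k => γ k * ‖p (k + 1) - p k‖) :
    (Summable fun k => γ k * disagreement (v k)) ∧
      Summable fun k => γ k * disagreement (v (k + 1)) := by
  obtain ⟨b, hb0, hb, hle⟩ := h.exists_disagreement_le hW
  have hC := hW.C_pos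
  have hf : Summable fun k => γ k * (N * C * N * ‖p (k + 1) - p k‖) :=
    (hs.mul_left (N * C * N : ℝ)).congr fun k => by ring
  have hγb : Summable fun k => γ k * b k := by
    refine summable_of_contraction hW.ρ_lt_one (fun k => mul_nonneg (h0 k) (hb0 k))
      (fun k => ?_) (fun k => mul_nonneg (h0 k) (by positivity)) hf
    calc γ (k + 1) * b (k + 1) ≤ γ k * (ρ * b k + N * C * N * ‖p (k + 1) - p k‖) :=
          mul_le_mul (hanti k.le_succ) (hb k) (hb0 _) (h0 k)
      _ = _ := by ring
  refine ⟨summable_mul_of_eventually_le h0 (fun _ => disagreement_nonneg _)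
      (Eventually.of_forall hle) hγb,
    summable_mul_of_eventually_le h0 (fun _ => disagreement_nonneg _)
      (Eventually.of_forall fun k => (hle (k + 1)).trans (hb k)) ?_⟩
  exact ((hγb.mul_left ρ).add hf).congr fun k => by ring

theorem norm_mix_sub_avg_le (k : ℕ) :
    ‖mix (W k) (v k) - col fun _ => avg (p k)‖ ≤ disagreement (v k) := by
  rw [← h.avg_eq hW]
  exact _root_.norm_mix_sub_avg_le (hW.mem_doublyStochastic k) _

theorem norm_mix_succ_sub_mix_le (k : ℕ) :
    ‖mix (W (k + 1)) (v (k + 1)) - mix (W k) (v k)‖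
      ≤ disagreement (v (k + 1)) + disagreement (v k) + ‖p (k + 1) - p k‖ := by
  have hsplit : mix (W (k + 1)) (v (k + 1)) - mix (W k) (v k)
      = (mix (W (k + 1)) (v (k + 1)) - col fun _ => avg (p (k + 1)))
        - (mix (W k) (v k) - col fun _ => avg (p k)) + col fun _ => avg (p (k + 1) - p k) := by
    ext1 i
    simp only [PiLp.add_apply, PiLp.sub_apply, col_apply, avg_sub]
    abel
  rw [hsplit]
  exact (norm_add_le _ _).trans (add_le_add ((norm_sub_le _ _).trans (add_le_add
    (h.norm_mix_sub_avg_le hW _) (h.norm_mix_sub_avg_le hW _))) (norm_col_avg_le _))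

theorem summable_mul_norm_mix_succ_sub_mix {γ : ℕ → ℝ} (h0 : ∀ k, 0 ≤ γ k) (hanti : Antitone γ)
    (hs : Summable fun k => γ k * ‖p (k + 1) - p k‖) :
    Summable fun k => γ k * ‖mix (W (k + 1)) (v (k + 1)) - mix (W k) (v k)‖ := by
  obtain ⟨hD, hD'⟩ := h.summable_mul_disagreement hW h0 hanti hs
  exact summable_mul_of_eventually_le h0 (fun _ => norm_nonneg _)
    (Eventually.of_forall (h.norm_mix_succ_sub_mix_le hW))
    (((hD'.add hD).add hs).congr fun k => by ring)

end TracksAverage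

theorem QConnected.nonempty {N : ℕ} {G : ℕ → SimpleGraph (Fin N)} (hG : QConnected G) :
    Nonempty (Fin N) := by
  obtain ⟨Q, -, hQ⟩ := hG
  exact (hQ 0).nonempty

theorem IsMixing.exists_mixesGeometrically {N : ℕ} {G : ℕ → SimpleGraph (Fin N)}
    {W : ℕ → Matrix (Fin N) (Fin N) ℝ} (hW : IsMixing G W) (hG : QConnected G) :
    (∃ C ρ, MixesGeometrically W C ρ) ∧ ∃ ε, 0 < ε ∧ ∀ k i, ε ≤ W k i i := by
  have := hG.nonempty
  obtain ⟨Q, -, hQ⟩ := hG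
  obtain ⟨ε, hε, hW⟩ := hW
  have hdiag : ∀ k i, ε ≤ W k i i := fun k i => ((hW k).2.1 i).le
  have hadj : ∀ k i l, (G k).Adj i l → ε ≤ W k i l := fun k i l h => ((hW k).1 i l h.ne).1 h
  have hnonneg : ∀ k i l, 0 ≤ W k i l := fun k i l => by
    rcases eq_or_ne i l with rfl | hil
    · exact hε.le.trans (hdiag k i)
    · by_cases h : (G k).Adj i l
      · exact hε.le.trans (hadj k i l h)
      · exact (((hW k).1 i l hil).2 h).ge
  obtain ⟨T, hT0, hT⟩ := exists_pow_le_transition hε.le hnonneg hdiag hadj hQ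
  have hds : ∀ k, W k ∈ doublyStochastic ℝ (Fin N) := fun k =>
    mem_doublyStochastic_iff_sum.2 ⟨hnonneg k, (hW k).2.2.1, (hW k).2.2.2⟩
  exact ⟨_root_.exists_mixesGeometrically hds hT0 (pow_pos hε T) hT, ε, hε, hdiag⟩

section BlockMap

variable {N d e : ℕ}

/-- The block-diagonal map `x ↦ col(A_i x_i)`. -/
noncomputable def blockMap (A : Fin N → Vec d →L[ℝ] Vec e) : Stack N d →L[ℝ] Stack N e where
  toFun x := col fun i => A i (x i)
  map_add' x y := by ext1 i; simp
  map_smul' r x := by ext1 i; simp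
  cont := by unfold col; fun_prop

@[simp] theorem blockMap_apply (A : Fin N → Vec d →L[ℝ] Vec e) (x : Stack N d) (i : Fin N) :
    blockMap A x i = A i (x i) := rfl

/-- The block-diagonal map `x ↦ col(a_i x_i)`. -/
noncomputable def blockScale (a : Fin N → ℝ) : Stack N d →L[ℝ] Stack N d :=
  blockMap fun i => a i • ContinuousLinearMap.id ℝ (Vec d)

@[simp] theorem blockScale_apply (a : Fin N → ℝ) (x : Stack N d) (i : Fin N) :
    blockScale a x i = a i • x i := rfl

/-- The blockwise projection onto the product of the sets `S i`. -/
noncomputable def blockProj (S : Fin N → Set (Vec d)) (x : Stack N d) : Stack N d :=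
  col fun i => proj (S i) (x i)

variable {S : Fin N → Set (Vec d)} (hcl : ∀ i, IsClosed (S i)) (hne : ∀ i, (S i).Nonempty)

include hcl hne in
theorem blockProj_mem (x : Stack N d) : blockProj S x ∈ prodSet S :=
  fun i => (proj_spec (hcl i) (hne i) (x i)).1

variable (hconv : ∀ i, Convex ℝ (S i))
include hcl hne hconv

theorem norm_blockProj_sub_blockProj_le (x y : Stack N d) :
    ‖blockProj S x - blockProj S y‖ ≤ ‖x - y‖ := by
  rw [← sq_le_sq₀ (norm_nonneg _) (norm_nonneg _), PiLp.norm_sq_eq_of_L2, PiLp.norm_sq_eq_of_L2]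
  gcongr with i
  exact norm_proj_sub_proj_le (hcl i) (hconv i) (hne i) (x i) (y i)

theorem norm_blockProj_step_sub_le (a : Fin N → ℝ) (p p' q q' : Stack N d) :
    ‖blockProj S (p + blockScale a q) - blockProj S (p' + blockScale a q')‖
      ≤ ‖p - p'‖ + ‖(blockScale a : Stack N d →L[ℝ] Stack N d)‖ * ‖q - q'‖ := by
  refine (norm_blockProj_sub_blockProj_le hcl hne hconv _ _).trans ?_
  rw [add_sub_add_comm, ← map_sub]
  exact (norm_add_le _ _).trans (by gcongr; exact ContinuousLinearMap.le_opNorm _ _)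

theorem inv_smul_sub_blockProj_step_mem_normalCone {a : Fin N → ℝ} (ha : ∀ i, 0 < a i)
    (p q : Stack N d) :
    blockScale (fun i => (a i)⁻¹) (p - blockProj S (p + blockScale a q)) + q
      ∈ normalCone (prodSet S) (blockProj S (p + blockScale a q)) := by
  refine mem_normalCone_prodSet.2 fun i => ?_
  obtain ⟨hmem, hle⟩ := sub_proj_mem_normalCone (hcl i) (hconv i) (hne i) (p i + a i • q i)
  refine ⟨hmem, fun z hz => ?_⟩
  have hscale : (blockScale (fun i => (a i)⁻¹) (p - blockProj S (p + blockScale a q)) + q) i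
      = (a i)⁻¹ • (p i + a i • q i - proj (S i) (p i + a i • q i)) := by
    rw [add_sub_right_comm, smul_add, inv_smul_smul₀ (ha i).ne']
    rfl
  rw [hscale, real_inner_smul_left]
  exact mul_nonpos_of_nonneg_of_nonpos (inv_nonneg.2 (ha i).le) (hle z hz)

end BlockMap

theorem blockProj_orthant_zero {N m : ℕ} :
    blockProj (fun _ : Fin N => orthant m) 0 = 0 := by
  refine PiLp.ext fun i => ?_
  simpa [blockProj] using (proj_spec (isClosed_orthant m) ⟨0, zero_mem_orthant m⟩ 0).2
    0 (zero_mem_orthant m)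

theorem norm_blockProj_orthant_le {N m : ℕ} (l : Stack N m) :
    ‖blockProj (fun _ => orthant m) l‖ ≤ ‖l‖ := by
  simpa only [blockProj_orthant_zero, sub_zero] using norm_blockProj_sub_blockProj_le
    (fun _ => isClosed_orthant m) (fun _ => ⟨0, zero_mem_orthant m⟩) (fun _ => convex_orthant m) l 0

namespace AggGame

variable {N n m : ℕ} {g : AggGame N n m}

theorem Regular.exists_norm_le (hg : g.Regular) : ∃ R, ∀ v ∈ prodSet g.Ω, ‖v‖ ≤ R := by
  obtain ⟨R, hR⟩ := (isCompact_iUnion hg.compact).isBounded.exists_norm_le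
  exact ⟨∑ _ : Fin N, R, fun v hv => (norm_le_sum_norm v).trans
    (Finset.sum_le_sum fun i _ => hR _ (Set.mem_iUnion.2 ⟨i, hv i⟩))⟩

theorem Regular.pseudoGrad_eq_extPseudoGrad [NeZero N] (hg : g.Regular) {x : Stack N n}
    (hx : x ∈ prodSet g.Ω) : g.pseudoGrad x = g.extPseudoGrad x (col fun _ => avg x) :=
  PiLp.ext (hg.pseudoGrad_apply hx)

theorem LipschitzOver.exists_norm_sub_le {S : Set (Vec n)} (h : g.LipschitzOver S) :
    ∃ L : ℝ, 0 < L ∧ ∀ v ∈ prodSet g.Ω, ∀ u ∈ prodSet g.Ω, ∀ w ∈ prodSet (fun _ : Fin N => S),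
      ∀ z ∈ prodSet (fun _ : Fin N => S),
        ‖g.extPseudoGrad v w - g.extPseudoGrad u z‖ ≤ L * (‖v - u‖ + ‖w - z‖) := by
  obtain ⟨L, hL, h⟩ := h
  refine ⟨L, hL, fun v hv u hu w hw z hz => (h v hv u hu w hw z hz).trans ?_⟩
  gcongr
  exact Real.sqrt_le_iff.2 ⟨by positivity, by nlinarith [norm_nonneg (v - u), norm_nonneg (w - z)]⟩

/-- The sequences generated by the algorithm; `d k` collects the vectors
`C_i (2 x̃_i^{k-1} - x_i^{k-1}) - c_i`, whose average is tracked by `y k`. -/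
structure IsTrajectory (g : AggGame N n m) (α β : Fin N → ℝ) (W : ℕ → Matrix (Fin N) (Fin N) ℝ)
    (γ : ℕ → ℝ) (x xt σ : ℕ → Stack N n) (lam lt y z d : ℕ → Stack N m) : Prop where
  x_mem : x 0 ∈ prodSet g.Ω
  lam_mem : lam 0 ∈ prodSet fun _ : Fin N => orthant m
  tracks_σ : TracksAverage W x σ
  tracks_z : TracksAverage W lam z
  tracks_y : TracksAverage W d y
  xt_eq : ∀ k, xt k = blockProj g.Ω (x k + blockScale α (-(g.extPseudoGrad (x k)
    (mix (W k) (σ k)) + blockMap (fun i => (g.C i).adjoint) (mix (W k) (z k)))))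
  lt_eq : ∀ k, lt k = blockProj (fun _ => orthant m)
    (lam k + blockScale β (y (k + 1) - lam k + mix (W k) (z k)))
  x_succ : ∀ k, x (k + 1) = x k + γ k • (xt k - x k)
  lam_succ : ∀ k, lam (k + 1) = lam k + γ k • (lt k - lam k)
  d_succ : ∀ k, d (k + 1) = blockMap g.C ((2 : ℝ) • xt k - x k) - col g.c

theorem isTrajectory_alg (α β : Fin N → ℝ) (W : ℕ → Matrix (Fin N) (Fin N) ℝ) (γ : ℕ → ℝ)
    (xm xtm : Stack N n) {x0 : Stack N n} {l0 : Stack N m} (hx0 : x0 ∈ prodSet g.Ω)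
    (hl0 : l0 ∈ prodSet fun _ : Fin N => orthant m) :
    ∃ xt σ lt y z d, g.IsTrajectory α β W γ (fun k => (g.alg α β W γ xm xtm x0 l0 k).x) xt σ
      (fun k => (g.alg α β W γ xm xtm x0 l0 k).lam) lt y z d := by
  set s := g.alg α β W γ xm xtm x0 l0
  refine ⟨fun k => (s (k + 1)).xtPrev, fun k => (s k).σ,
    fun k => blockProj (fun _ => orthant m)
      ((s k).lam + blockScale β ((s (k + 1)).y - (s k).lam + mix (W k) (s k).z)),
    fun k => (s k).y, fun k => (s k).z,
    fun k => blockMap g.C ((2 : ℝ) • (s k).xtPrev - (s k).xPrev) - col g.c,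
    { x_mem := hx0
      lam_mem := hl0
      tracks_σ := ⟨rfl, fun k => add_sub_assoc _ _ _⟩
      tracks_z := ⟨rfl, fun k => add_sub_assoc _ _ _⟩
      tracks_y := ⟨PiLp.ext fun i => ?_, fun k => PiLp.ext fun i => ?_⟩
      xt_eq := fun k => PiLp.ext fun i => ?_
      lt_eq := fun k => rfl
      x_succ := fun k => rfl
      lam_succ := fun k => rfl
      d_succ := fun k => rfl }⟩
  · simp [s, alg, algInit]
  · simp only [PiLp.add_apply, PiLp.sub_apply, blockMap_apply, sub_sub_sub_cancel_right]
    exact add_sub_assoc _ _ _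
  · rw [blockProj, map_neg, ← sub_eq_add_neg]
    rfl

namespace IsTrajectory

variable {α β : Fin N → ℝ} {W : ℕ → Matrix (Fin N) (Fin N) ℝ} {γ : ℕ → ℝ}
  {x xt σ : ℕ → Stack N n} {lam lt y z d : ℕ → Stack N m}
  (h : g.IsTrajectory α β W γ x xt σ lam lt y z d)
include h

theorem d_avg_succ (k : ℕ) : avg (d (k + 1))
    = (1 / (N : ℝ)) • ((2 : ℝ) • g.total (xt k) - g.total (x k) - ∑ i, g.c i) := by
  rw [h.d_succ, avg]
  simp [total, Finset.smul_sum]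

variable (hg : g.Regular)
include hg

theorem xt_mem (k : ℕ) : xt k ∈ prodSet g.Ω := by
  rw [h.xt_eq]
  exact blockProj_mem (fun i => (hg.compact i).isClosed) (fun i => ⟨x 0 i, h.x_mem i⟩) _

variable (hγ : VanishingSteps γ)
include hγ

theorem x_mem_all (k : ℕ) : x k ∈ prodSet g.Ω :=
  mem_of_relaxation (convex_prodSet hg.convex) hγ.nonneg hγ.le_one h.x_mem (h.xt_mem hg) h.x_succ k

theorem exists_norm_d_le : ∃ R, ∀ k, ‖d k‖ ≤ R := by
  obtain ⟨R, hR⟩ := hg.exists_norm_le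
  refine ⟨max ‖d 0‖ (‖blockMap g.C‖ * (2 * R + R) + ‖(col g.c : Stack N m)‖), fun k => ?_⟩
  cases k with
  | zero => exact le_max_left _ _
  | succ k =>
    rw [h.d_succ]
    refine le_max_of_le_right ((norm_sub_le _ _).trans ?_)
    gcongr
    refine (ContinuousLinearMap.le_opNorm _ _).trans ?_
    gcongr
    refine (norm_sub_le _ _).trans (add_le_add ?_ (hR _ (h.x_mem_all hg hγ k)))
    rw [norm_smul, Real.norm_two]
    gcongr
    exact hR _ (h.xt_mem hg k)

variable {C ρ : ℝ} (hW : MixesGeometrically W C ρ)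
include hW

theorem exists_norm_lt_le {B : ℝ} (hB : ∀ k, ‖lam k‖ ≤ B) : ∃ R, ∀ k, ‖lt k‖ ≤ R := by
  obtain ⟨Rd, hRd⟩ := h.exists_norm_d_le hg hγ
  obtain ⟨Ry, hRy⟩ := h.tracks_y.exists_norm_le hW hRd
  obtain ⟨Rz, hRz⟩ := h.tracks_z.exists_norm_le hW hB
  refine ⟨B + ‖(blockScale β : Stack N m →L[ℝ] Stack N m)‖ * (Ry + B + Rz), fun k => ?_⟩
  rw [h.lt_eq]
  refine (norm_blockProj_orthant_le _).trans ((norm_add_le _ _).trans ?_)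
  gcongr
  · exact hB k
  refine (ContinuousLinearMap.le_opNorm _ _).trans ?_
  gcongr
  exact (norm_add_le _ _).trans (add_le_add
    ((norm_sub_le _ _).trans (add_le_add (hRy _) (hB k)))
    ((norm_mix_le (hW.mem_doublyStochastic k) _).trans (hRz k)))

theorem exists_forall_ge_mix_mem_hull {ε : ℝ} (hε : 0 < ε) (hdiag : ∀ k i, ε ≤ W k i i)
    (hγ1 : γ 0 < 1) :
    ∃ K, ∀ k ≥ K, mix (W k) (σ k) ∈ prodSet fun _ : Fin N => g.hull := by
  have hsub : ∀ i, g.Ω i ⊆ g.hull := fun i v hv =>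
    subset_convexHull ℝ _ (Set.mem_iUnion.2 ⟨i, hv⟩)
  have hconv : Convex ℝ g.hull := convex_convexHull ℝ _
  obtain ⟨K, hK⟩ := exists_response_nonneg hW hε hdiag (antitone_nat_of_succ_le hγ.anti)
    hγ.nonneg hγ1 hγ.tendsto_zero
  refine ⟨K, fun k hk i => ?_⟩
  have hσ : ∀ j, σ k j ∈ g.hull := tracking_mem_of_response_nonneg hconv hW.mem_doublyStochastic
    hγ.nonneg hK (a := fun k i => x k i) (b := fun k i => xt k i) (s := fun k i => σ k i)
    (fun k i => by simp [h.x_succ]) (fun k i => by simp [h.tracks_σ.succ, mix])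
    (by simp [h.tracks_σ.init]) (fun i => hsub i (h.x_mem i)) (fun k i => hsub i (h.xt_mem hg k i))
    hk
  exact hconv.sum_mem (fun j _ => hW.nonneg k i j)
    (sum_row_of_mem_doublyStochastic (hW.mem_doublyStochastic k) i) fun j _ => hσ j

theorem eventually_mix_mem_thickening [NeZero N] {r : ℝ} (hr : 0 < r) :
    ∀ᶠ k in atTop, mix (W k) (σ k) ∈ prodSet fun _ : Fin N => Metric.thickening r g.hull := by
  obtain ⟨R, hR⟩ := hg.exists_norm_le
  have hinc := hγ.tendsto_norm_increment h.x_succ (fun k => hR _ (h.x_mem_all hg hγ k))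
    fun k => hR _ (h.xt_mem hg k)
  filter_upwards [(h.tracks_σ.tendsto_disagreement hW hinc).eventually_lt_const hr] with k hk i
  refine Metric.mem_thickening_iff.2 ⟨avg (x k), avg_mem_hull (h.x_mem_all hg hγ k), ?_⟩
  rw [dist_eq_norm]
  exact ((PiLp.norm_apply_le _ i).trans (h.tracks_σ.norm_mix_sub_avg_le hW k)).trans_lt hk

theorem exists_lipschitzOver [NeZero N] {ε : ℝ} (hε : 0 < ε) (hdiag : ∀ k i, ε ≤ W k i i)
    (hL : g.LipschitzOver g.hull)
    (hL' : γ 0 = 1 → ∃ r : ℝ, 0 < r ∧ g.LipschitzOver (Metric.thickening r g.hull)) :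
    ∃ S, g.LipschitzOver S ∧ g.hull ⊆ S ∧
      ∀ᶠ k in atTop, mix (W k) (σ k) ∈ prodSet fun _ : Fin N => S := by
  rcases (hγ.le_one 0).lt_or_eq with h1 | h1
  · exact ⟨g.hull, hL, subset_rfl,
      eventually_atTop.2 (h.exists_forall_ge_mix_mem_hull hg hγ hW hε hdiag h1)⟩
  · obtain ⟨r, hr, hLr⟩ := hL' h1
    exact ⟨_, hLr, Metric.self_subset_thickening hr _,
      h.eventually_mix_mem_thickening hg hγ hW hr⟩

end IsTrajectory

end AggGame

namespace AggGame

variable {N n m : ℕ}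

/-- The deviation of iteration `k` from an exact preconditioned forward-backward step, caused by
replacing averages with tracking variables. -/
noncomputable def trackingError (g : AggGame N n m) (W : ℕ → Matrix (Fin N) (Fin N) ℝ)
    (x σ : ℕ → Stack N n) (lam y z d : ℕ → Stack N m) (k : ℕ) : PrimalDual N n m :=
  WithLp.toLp 2
    (g.extPseudoGrad (x k) (mix (W k) (σ k)) - g.pseudoGrad (x k)
        + blockMap (fun i => (g.C i).adjoint) (mix (W k) (z k) - col fun _ => avg (lam k)),
      (col (fun _ => avg (d (k + 1))) - y (k + 1))
        + (col (fun _ => avg (lam k)) - mix (W k) (z k)))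

variable {g : AggGame N n m} {α β : Fin N → ℝ} {W : ℕ → Matrix (Fin N) (Fin N) ℝ} {γ : ℕ → ℝ}
  {x xt σ : ℕ → Stack N n} {lam lt y z d : ℕ → Stack N m}

namespace IsTrajectory

variable (h : g.IsTrajectory α β W γ x xt σ lam lt y z d)
include h

theorem primal_mem_normalCone (hg : g.Regular) (hα : ∀ i, 0 < α i) (k : ℕ) :
    blockScale (fun i => (α i)⁻¹) (x k - xt k) - (g.extPseudoGrad (x k) (mix (W k) (σ k))
        + blockMap (fun i => (g.C i).adjoint) (mix (W k) (z k)))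
      ∈ normalCone (prodSet g.Ω) (xt k) := by
  have hstep := inv_smul_sub_blockProj_step_mem_normalCone (fun i => (hg.compact i).isClosed)
    (fun i => ⟨x 0 i, h.x_mem i⟩) hg.convex hα (x k) (-(g.extPseudoGrad (x k)
      (mix (W k) (σ k)) + blockMap (fun i => (g.C i).adjoint) (mix (W k) (z k))))
  rwa [← h.xt_eq, ← sub_eq_add_neg] at hstep

theorem dual_mem_normalCone (hβ : ∀ i, 0 < β i) (k : ℕ) :
    blockScale (fun i => (β i)⁻¹) (lam k - lt k) + (y (k + 1) - lam k + mix (W k) (z k))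
      ∈ normalCone (prodSet fun _ => orthant m) (lt k) := by
  have hstep := inv_smul_sub_blockProj_step_mem_normalCone (fun _ => isClosed_orthant m)
    (fun _ => ⟨0, zero_mem_orthant m⟩) (fun _ => convex_orthant m) hβ (lam k)
    (y (k + 1) - lam k + mix (W k) (z k))
  rwa [← h.lt_eq] at hstep

theorem isInexactForwardBackward (hg : g.Regular) (hα : ∀ i, 0 < α i) (hβ : ∀ i, 0 < β i) :
    IsInexactForwardBackward g.primalDualSet (g.precond α β) (g.couplingOp (-1)) g.forwardOp γ
      (g.trackingError W x σ lam y z d) (fun k => WithLp.toLp 2 (x k, lam k))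
      (fun k => WithLp.toLp 2 (xt k, lt k)) where
  init := ⟨h.x_mem, h.lam_mem⟩
  inclusion k := by
    refine mem_normalCone_primalDual.2 ⟨?_, ?_⟩
    · change _ ∈ normalCone (prodSet g.Ω) (xt k)
      convert h.primal_mem_normalCone hg hα k using 1
      refine PiLp.ext fun i => ?_
      simp only [precond, couplingOp, forwardOp, trackingError, LinearMap.coe_mk, AddHom.coe_mk,
        WithLp.sub_fst, WithLp.toLp_fst, WithLp.toLp_snd, PiLp.sub_apply, PiLp.add_apply,
        col_apply, blockScale_apply, blockMap_apply, map_sub]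
      abel
    · change _ ∈ normalCone (prodSet fun _ => orthant m) (lt k)
      convert h.dual_mem_normalCone hβ k using 1
      refine PiLp.ext fun i => ?_
      simp only [precond, couplingOp, forwardOp, trackingError, h.d_avg_succ, g.total_sub,
        LinearMap.coe_mk, AddHom.coe_mk, WithLp.sub_fst, WithLp.sub_snd, WithLp.toLp_fst,
        WithLp.toLp_snd, PiLp.sub_apply, PiLp.add_apply, PiLp.smul_apply, col_apply,
        blockScale_apply]
      module
  relax k := primalDual_ext (fun i => by simp [h.x_succ]) fun i => by simp [h.lam_succ]

variable (hg : g.Regular) (hγ : VanishingSteps γ) {C ρ : ℝ} (hW : MixesGeometrically W C ρ)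
include hg hγ

theorem exists_norm_xt_increment_le {S : Set (Vec n)} (hS : g.LipschitzOver S)
    (hmem : ∀ᶠ k in atTop, mix (W k) (σ k) ∈ prodSet fun _ : Fin N => S) :
    ∃ L : ℝ, ∀ᶠ k in atTop, ‖xt (k + 1) - xt k‖ ≤ L * (‖x (k + 1) - x k‖
      + ‖mix (W (k + 1)) (σ (k + 1)) - mix (W k) (σ k)‖
      + ‖mix (W (k + 1)) (z (k + 1)) - mix (W k) (z k)‖) := by
  obtain ⟨L, hL, hS⟩ := hS.exists_norm_sub_le
  set a := ‖(blockScale α : Stack N n →L[ℝ] Stack N n)‖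
  set c := ‖blockMap fun i => (g.C i).adjoint‖
  refine ⟨1 + a * (L + c), ?_⟩
  filter_upwards [hmem, (tendsto_add_atTop_nat 1).eventually hmem] with k hk hk1
  have hstep := norm_blockProj_step_sub_le (fun i => (hg.compact i).isClosed)
    (fun i => ⟨x 0 i, h.x_mem i⟩) hg.convex α (x (k + 1)) (x k)
    (-(g.extPseudoGrad (x (k + 1)) (mix (W (k + 1)) (σ (k + 1)))
      + blockMap (fun i => (g.C i).adjoint) (mix (W (k + 1)) (z (k + 1)))))
    (-(g.extPseudoGrad (x k) (mix (W k) (σ k))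
      + blockMap (fun i => (g.C i).adjoint) (mix (W k) (z k))))
  rw [← h.xt_eq, ← h.xt_eq, ← neg_sub', norm_neg, add_sub_add_comm, ← map_sub] at hstep
  have hgrad := hS _ (h.x_mem_all hg hγ (k + 1)) _ (h.x_mem_all hg hγ k) _ hk1 _ hk
  have hadj := (blockMap fun i => (g.C i).adjoint).le_opNorm
    (mix (W (k + 1)) (z (k + 1)) - mix (W k) (z k))
  set X := ‖x (k + 1) - x k‖
  set s := ‖mix (W (k + 1)) (σ (k + 1)) - mix (W k) (σ k)‖
  set t := ‖mix (W (k + 1)) (z (k + 1)) - mix (W k) (z k)‖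
  calc ‖xt (k + 1) - xt k‖ ≤ X + a * (L * (X + s) + c * t) :=
        hstep.trans (by gcongr; exact (norm_add_le _ _).trans (add_le_add hgrad hadj))
    _ ≤ (1 + a * (L + c)) * (X + s + t) := by
        have : 0 ≤ (s + t) + a * (L * t + c * (X + s)) := by positivity
        linarith

theorem exists_norm_trackingError_le [NeZero N] {S : Set (Vec n)} (hS : g.LipschitzOver S)
    (hsub : g.hull ⊆ S) (hmem : ∀ᶠ k in atTop, mix (W k) (σ k) ∈ prodSet fun _ : Fin N => S)
    (hW : MixesGeometrically W C ρ) :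
    ∃ L : ℝ, ∀ᶠ k in atTop, ‖g.trackingError W x σ lam y z d k‖ ≤
      L * (disagreement (σ k) + disagreement (z k) + disagreement (y (k + 1))) := by
  obtain ⟨L, hL, hS⟩ := hS.exists_norm_sub_le
  set c := ‖blockMap fun i => (g.C i).adjoint‖
  refine ⟨L + c + 1, hmem.mono fun k hk => ?_⟩
  have hx := h.x_mem_all hg hγ k
  have hgrad : ‖g.extPseudoGrad (x k) (mix (W k) (σ k)) - g.pseudoGrad (x k)‖
      ≤ L * disagreement (σ k) := by
    have hlip := hS _ hx _ hx _ hk (col fun _ => avg (x k)) fun _ => hsub (avg_mem_hull hx)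
    rw [sub_self, norm_zero, zero_add, ← hg.pseudoGrad_eq_extPseudoGrad hx] at hlip
    exact hlip.trans (by gcongr; exact h.tracks_σ.norm_mix_sub_avg_le hW k)
  have hz := h.tracks_z.norm_mix_sub_avg_le hW k
  have hadj : ‖blockMap (fun i => (g.C i).adjoint) (mix (W k) (z k) - col fun _ => avg (lam k))‖
      ≤ c * disagreement (z k) :=
    (ContinuousLinearMap.le_opNorm _ _).trans (by gcongr)
  have hy : ‖col (fun _ => avg (d (k + 1))) - y (k + 1)‖ = disagreement (y (k + 1)) := by
    rw [norm_sub_rev, ← h.tracks_y.avg_eq hW, disagreement]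
  rw [norm_sub_rev] at hz
  calc ‖g.trackingError W x σ lam y z d k‖
      ≤ (L * disagreement (σ k) + c * disagreement (z k))
        + (disagreement (y (k + 1)) + disagreement (z k)) :=
        (norm_primalDual_le _).trans (add_le_add
          ((norm_add_le _ _).trans (add_le_add hgrad hadj))
          ((norm_add_le _ _).trans (add_le_add hy.le hz)))
    _ ≤ _ := by
        have := disagreement_nonneg (σ k)
        have := disagreement_nonneg (z k)
        have := disagreement_nonneg (y (k + 1))
        have : 0 ≤ (c + 1) * disagreement (σ k) + L * disagreement (z k)
          + (L + c) * disagreement (y (k + 1)) := by positivity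
        linarith

variable (hx : Summable fun k => γ k * ‖x (k + 1) - x k‖)
  (hlam : Summable fun k => γ k * ‖lam (k + 1) - lam k‖)
include hW hx hlam

theorem summable_mul_norm_d_increment {S : Set (Vec n)} (hS : g.LipschitzOver S)
    (hmem : ∀ᶠ k in atTop, mix (W k) (σ k) ∈ prodSet fun _ : Fin N => S) :
    Summable fun k => γ k * ‖d (k + 1) - d k‖ := by
  have hanti := antitone_nat_of_succ_le hγ.anti
  obtain ⟨L, hL⟩ := h.exists_norm_xt_increment_le hg hγ hS hmem
  have hσ := h.tracks_σ.summable_mul_norm_mix_succ_sub_mix hW hγ.nonneg hanti hx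
  have hz := h.tracks_z.summable_mul_norm_mix_succ_sub_mix hW hγ.nonneg hanti hlam
  have hxt : Summable fun k => γ k * ‖xt (k + 1) - xt k‖ :=
    summable_mul_of_eventually_le hγ.nonneg (fun _ => norm_nonneg _) hL
      ((((hx.add hσ).add hz).mul_left L).congr fun k => by ring)
  have hd : ∀ k, ‖d (k + 2) - d (k + 1)‖
      ≤ ‖blockMap g.C‖ * (2 * ‖xt (k + 1) - xt k‖ + ‖x (k + 1) - x k‖) := fun k => by
    rw [h.d_succ, h.d_succ, sub_sub_sub_cancel_right, ← map_sub, sub_sub_sub_comm, ← smul_sub]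
    refine (ContinuousLinearMap.le_opNorm _ _).trans ?_
    gcongr
    exact (norm_sub_le _ _).trans_eq (by rw [norm_smul, Real.norm_two])
  refine (summable_nat_add_iff 1).1 (Summable.of_nonneg_of_le
    (fun k => mul_nonneg (hγ.nonneg _) (norm_nonneg _))
    (fun k => mul_le_mul (hγ.anti k) (hd k) (norm_nonneg _) (hγ.nonneg k)) ?_)
  exact (((hxt.mul_left 2).add hx).mul_left ‖blockMap g.C‖).congr fun k => by ring

theorem summable_mul_norm_trackingError [NeZero N] {S : Set (Vec n)} (hS : g.LipschitzOver S)
    (hsub : g.hull ⊆ S) (hmem : ∀ᶠ k in atTop, mix (W k) (σ k) ∈ prodSet fun _ : Fin N => S) :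
    Summable fun k => γ k * ‖g.trackingError W x σ lam y z d k‖ := by
  have hanti := antitone_nat_of_succ_le hγ.anti
  have hd := h.summable_mul_norm_d_increment hg hγ hW hx hlam hS hmem
  obtain ⟨L, hL⟩ := h.exists_norm_trackingError_le hg hγ hS hsub hmem hW
  refine summable_mul_of_eventually_le hγ.nonneg (fun _ => norm_nonneg _) hL ?_
  exact ((((h.tracks_σ.summable_mul_disagreement hW hγ.nonneg hanti hx).1.add
    (h.tracks_z.summable_mul_disagreement hW hγ.nonneg hanti hlam).1).add
    (h.tracks_y.summable_mul_disagreement hW hγ.nonneg hanti hd).2).mul_left L).congr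
      fun k => by ring

end IsTrajectory

end AggGame

namespace AggGame

variable {N n m : ℕ} {g : AggGame N n m}

theorem IsTrajectory.exists_tendsto_isZeroT [NeZero N] {χ δ τ C ρ ε B : ℝ} {α β : Fin N → ℝ}
    {W : ℕ → Matrix (Fin N) (Fin N) ℝ} {γ : ℕ → ℝ} {x xt σ : ℕ → Stack N n}
    {lam lt y z d : ℕ → Stack N m} (h : g.IsTrajectory α β W γ x xt σ lam lt y z d)
    (hg : g.Regular) (hF : g.Cocoercive χ) (hL : g.LipschitzOver g.hull)
    (hW : MixesGeometrically W C ρ) (hε : 0 < ε) (hdiag : ∀ k i, ε ≤ W k i i)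
    (hαβ : g.StepSizes χ δ τ α β) (hγ : VanishingSteps γ)
    (hL' : γ 0 = 1 → ∃ r : ℝ, 0 < r ∧ g.LipschitzOver (Metric.thickening r g.hull))
    (hB : ∀ k, ‖lam k‖ ≤ B) :
    ∃ xs ls, Tendsto (fun k => (x k, lam k)) atTop (𝓝 (xs, ls)) ∧ g.IsZeroT xs ls := by
  obtain ⟨R, hR⟩ := hg.exists_norm_le
  obtain ⟨Rl, hRl⟩ := h.exists_norm_lt_le hg hγ hW hB
  have hxt := fun k => hR _ (h.xt_mem hg k)
  have hx := hγ.summable_mul_norm_increment h.x_succ (fun k => hR _ (h.x_mem_all hg hγ k)) hxt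
  have hlam := hγ.summable_mul_norm_increment h.lam_succ hB hRl
  obtain ⟨S, hS, hsub, hmem⟩ := h.exists_lipschitzOver hg hγ hW hε hdiag hL hL'
  have herr := h.summable_mul_norm_trackingError hg hγ hW hx hlam hS hsub hmem
  obtain ⟨ws, hlim, hzero⟩ :=
    (h.isInexactForwardBackward hg hαβ.α_pos hαβ.β_pos).exists_tendsto
      (hg.isPreconditionedSplitting hF hαβ) hγ.nonneg hγ.le_one
      (fun k => (norm_primalDual_le _).trans (add_le_add (hxt k) (hRl k))) herr hγ.not_summable
  exact ⟨ws.fst, ws.snd, ((WithLp.prod_continuous_ofLp 2 _ _).tendsto ws).comp hlim,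
    neg_add_mem_normalCone_iff_isZeroT.1 hzero⟩

end AggGame

theorem theorem2_general {N n m : ℕ} (g : AggGame N n m) (hg : g.Regular)
    (χ : ℝ) (hF : g.Cocoercive χ) (hL : g.LipschitzOver g.hull)
    (G : ℕ → SimpleGraph (Fin N)) (hG : QConnected G)
    (W : ℕ → Matrix (Fin N) (Fin N) ℝ) (hW : IsMixing G W)
    (δ τ : ℝ) (α β : Fin N → ℝ) (hαβ : g.StepSizes χ δ τ α β)
    (γ : ℕ → ℝ) (hγ : VanishingSteps γ)
    (hL' : γ 0 = 1 → ∃ r : ℝ, 0 < r ∧ g.LipschitzOver (Metric.thickening r g.hull))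
    (xm xtm x0 : Stack N n) (hx0 : x0 ∈ prodSet g.Ω)
    (l0 : Stack N m) (hl0 : l0 ∈ prodSet fun _ : Fin N => orthant m)
    (hbdd : ∃ B : ℝ, ∀ k, ‖(g.alg α β W γ xm xtm x0 l0 k).lam‖ ≤ B) :
    ∃ (xs : Stack N n) (ls : Stack N m),
      Tendsto (fun k => ((g.alg α β W γ xm xtm x0 l0 k).x, (g.alg α β W γ xm xtm x0 l0 k).lam))
        atTop (𝓝 (xs, ls)) ∧
      g.IsZeroT xs ls ∧ g.IsVariationalGNE xs := by
  have : NeZero N := ⟨(Fin.pos_iff_nonempty.2 hG.nonempty).ne'⟩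
  obtain ⟨⟨C, ρ, hmix⟩, ε, hε, hdiag⟩ := hW.exists_mixesGeometrically hG
  obtain ⟨xt, σ, lt, y, z, d, h⟩ := AggGame.isTrajectory_alg α β W γ xm xtm hx0 hl0
  obtain ⟨B, hB⟩ := hbdd
  obtain ⟨xs, ls, hlim, hT⟩ :=
    h.exists_tendsto_isZeroT hg hF hL hmix hε hdiag hαβ hγ hL' hB
  exact ⟨xs, ls, hlim, hT, hg.isVariationalGNE_of_isZeroT hT⟩

theorem theorem2 {N n m : ℕ} (g : AggGame N n m) (hg : g.Standard)
    (χ : ℝ) (hχ : 0 < χ) (hF : g.Cocoercive χ)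
    (hL : g.LipschitzOver g.hull)
    (G : ℕ → SimpleGraph (Fin N)) (hG : QConnected G)
    (W : ℕ → Matrix (Fin N) (Fin N) ℝ) (hW : IsMixing G W)
    (δ τ : ℝ) (α β : Fin N → ℝ) (hαβ : g.StepSizes χ δ τ α β)
    (γ : ℕ → ℝ) (hγ : VanishingSteps γ)
    -- only in the borderline case `γ^0 = 1`: Lipschitz continuity a little beyond the hull
    (hL' : γ 0 = 1 → ∃ r : ℝ, 0 < r ∧ g.LipschitzOver (Metric.thickening r g.hull))
    (xm xtm x0 : Stack N n) (hxm : xm ∈ prodSet g.Ω) (hxtm : xtm ∈ prodSet g.Ω)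
    (hx0 : x0 ∈ prodSet g.Ω)
    (l0 : Stack N m) (hl0 : l0 ∈ prodSet fun _ : Fin N => orthant m)
    (hbdd : ∃ B : ℝ, 0 < B ∧ ∀ k, ‖(g.alg α β W γ xm xtm x0 l0 k).lam‖ ≤ B) :
    ∃ (xs : Stack N n) (ls : Stack N m),
      Tendsto (fun k => ((g.alg α β W γ xm xtm x0 l0 k).x, (g.alg α β W γ xm xtm x0 l0 k).lam))
        atTop (𝓝 (xs, ls)) ∧
      g.IsZeroT xs ls ∧ g.IsVariationalGNE xs :=
  let ⟨B, _, hB⟩ := hbdd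
  theorem2_general g hg.regular χ hF hL G hG W hW δ τ α β hαβ γ hγ hL' xm xtm x0 hx0 l0 hl0 ⟨B, hB⟩
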